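/- Let $(X,d,o)$ be a based geodesic metric space and let $G$ be a group acting on $X$ by isometries. Write $B_r$ and $\bar B_r$ for the open and closed balls of radius $r$ about $o$. Assume that the action is metrically proper, i.e. for all $x\in X$ and $r\ge 0$ the set $\{g\in G : d(x,g.o)\le r\}$ is finite, and that it has purely exponential growth, i.e. there are constants $\delta,\Delta,C>0$ such that for all $r\ge 0$ $$\tfrac1C e^{\delta r}\le \#\bigl(G.o\cap (B_{r+\Delta}\setminus B_r)\bigr)\le C e^{\delta r}.$$ For $Y\subset X$ and $x\in X$ put $\pi_Y(x)=\{y\in Y: d(x,y)=d(x,Y)\}$; the set $Y$ is *strongly contracting* if there is $C\ge 0$ such that $\operatorname{diam}(\pi_Y(x)\cup\pi_Y(x'))\le C$ for all $x,x'\in X$ with $d(x,x')\le d(x,Y)$. An element $c\in G$ is *strongly contracting* if it has infinite order and the set $\langle c\rangle.o$ is strongly contracting. For $H\subset G$ let $$\delta_H=\limsup_{r\to\infty}\frac{\log\#(H.o\cap\bar B_r)}{r},\qquad \Theta_H(s)=\sum_{y\in H.o}e^{-s\,d(y,o)},$$ and call $H$ *divergent* if $\delta_H$ is a real number and $\Theta_H(s)$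 diverges at $s=\delta_H$. Let $\hat H=\bigsqcup_{k\ge 1}(H\setminus\{1\})^k$. **Proposition.** Let $c\in G$ be a strongly contracting element. Then there are an integer $p\ge 1$ and a subset $G_4$ of the conjugacy class $[c^p]$ of $c^p$ in $G$ such that 1. $G_4$ is divergent; 2. $\delta_{G_4}=\delta_G/2$; 3. the map $\hat G_4\to X$, $(g_1,\dots,g_k)\mapsto \bigl(g_1c^{2p}\,g_2c^{2p}\cdots g_kc^{2p}\bigr).o$, is injective. -/

import Mathlib

open scoped ENNReal NNReal

namespace Cogrowth

/-- `X` is a geodesic metric space: any two points are the endpoints of an isometrically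
embedded compact interval. -/
def IsGeodesicSpace (X : Type*) [MetricSpace X] : Prop :=
  ∀ x y : X, ∃ γ : ℝ → X, γ 0 = x ∧ γ (dist x y) = y ∧
    ∀ s ∈ Set.Icc 0 (dist x y), ∀ t ∈ Set.Icc 0 (dist x y), dist (γ s) (γ t) = |s - t|

/-! ### Growth of subsets of a based metric space -/

section Growth

variable {X : Type*} [MetricSpace X]

/-- The shell `B_{r+Δ} - B_r` about `o`, where `B_r` is the open ball of radius `r`. -/
def shell (o : X) (r Δ : ℝ) : Set X :=
  Metric.ball o (r + Δ) \ Metric.ball o r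

/-- The exponential growth rate `limsup_{r → ∞} log #(Y ∩ closedBall o r) / r`, taken in the
extended reals (with `log 0 = -∞` and `log ∞ = ∞`). -/
noncomputable def growthRate (o : X) (Y : Set X) : EReal :=
  Filter.limsup
    (fun r : ℝ => ENNReal.log ((Y ∩ Metric.closedBall o r).encard : ℝ≥0∞) / (r : EReal))
    Filter.atTop

/-- The Poincaré series `∑_{y ∈ Y} exp (-s d(y, o))`, with values in `[0, ∞]`. -/
noncomputable def poincareSeries (o : X) (Y : Set X) (s : ℝ) : ℝ≥0∞ :=
  ∑' y : Y, ENNReal.ofReal (Real.exp (-s * dist (y : X) o))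

/-- `Y` is divergent: its growth rate is a real number, at which its Poincaré series diverges. -/
def IsDivergent (o : X) (Y : Set X) : Prop :=
  ∃ δ : ℝ, growthRate o Y = (δ : EReal) ∧ poincareSeries o Y δ = ∞

/-- `Y` has purely exponential growth: for some `δ, Δ > 0` the number of points of `Y` in the
shell `B_{r+Δ} - B_r` equals `exp (δ r)` up to a multiplicative constant independent of `r`. -/
def HasPurelyExponentialGrowth (o : X) (Y : Set X) : Prop :=
  ∃ δ : ℝ, 0 < δ ∧ ∃ Δ : ℝ, 0 < Δ ∧ ∃ C : ℝ, 0 < C ∧ ∀ r : ℝ, 0 ≤ r →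
    (Y ∩ shell o r Δ).Finite ∧
    Real.exp (δ * r) / C ≤ ((Y ∩ shell o r Δ).ncard : ℝ) ∧
    ((Y ∩ shell o r Δ).ncard : ℝ) ≤ C * Real.exp (δ * r)

end Growth

/-! ### Strong contraction -/

section Contraction

variable {X : Type*} [MetricSpace X]

/-- Closest point projection `π_Y(x) = {y ∈ Y | d(x, y) = d(x, Y)}`. -/
def closestPoints (Y : Set X) (x : X) : Set X :=
  {y | y ∈ Y ∧ dist x y = Metric.infDist x Y}

/-- `Y` is strongly contracting: there is `C ≥ 0` such that the diameter of
`π_Y(x) ∪ π_Y(x')` is at most `C` whenever `d(x, x') ≤ d(x, Y)`. -/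
def IsStronglyContractingSet (Y : Set X) : Prop :=
  ∃ C : ℝ≥0, ∀ x x' : X, dist x x' ≤ Metric.infDist x Y →
    Metric.ediam (closestPoints Y x ∪ closestPoints Y x') ≤ (C : ℝ≥0∞)

end Contraction

/-! ### Group actions -/

section Action

variable {G : Type*} [Group G] {X : Type*} [MetricSpace X] [MulAction G X]

/-- The set `H.o` of the translates of the base point `o` by the elements of `H ⊆ G`. -/
def orbitSet (o : X) (H : Set G) : Set X :=
  (fun g : G => g • o) '' H

variable (G) in
/-- The action of `G` is metrically proper: for all `x` and `r ≥ 0` only finitely many group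
elements `g` satisfy `d(x, g.o) ≤ r`. -/
def IsMetricallyProper (o : X) : Prop :=
  ∀ x : X, ∀ r : ℝ, 0 ≤ r → {g : G | dist x (g • o) ≤ r}.Finite

/-- `c` is a strongly contracting element: it has infinite order and `⟨c⟩.o` is a strongly
contracting set. -/
def IsStronglyContractingElement (o : X) (c : G) : Prop :=
  ¬ IsOfFinOrder c ∧
    IsStronglyContractingSet (orbitSet o (Subgroup.zpowers c : Set G))

/-- The "tree's worth of copies of `H`": the disjoint union over `k ≥ 1` of the sets of
`k`-tuples of elements of `H - {1}`, a tuple being written as a nonempty list. -/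
def treesWorth (H : Set G) : Set (List G) :=
  {l | l ≠ [] ∧ ∀ g ∈ l, g ∈ H ∧ g ≠ 1}

/-- The map `(g₁, …, g_k) ↦ (g₁ a g₂ a ⋯ g_k a).o`. -/
def treeMap (o : X) (a : G) (l : List G) : X :=
  (l.map fun g => g * a).prod • o

end Action

end Cogrowth

/-! Strong contraction yields a detour principle (`HasDetourConstant`): if two points have distant
projections to the axis `⟨c⟩.o`, then, up to a bounded error, their distance is the length of the
path through both projections. Call `h` good if `h.o` projects near `o` on the axis and `o` projects
near `h.o` on the `h`-translate. Then words in which good elements alternate with high powers of `c`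
trace almost geodesic paths, and `h * c ^ p * h⁻¹` has length `2 * len o h` up to a bounded error.
If `h` runs over a set of growth `δ`, its conjugates therefore grow at rate `δ / 2`.

Good elements are plentiful (`exists_isGood_growth`): projecting near `c ^ n • o` confines an
element to a ball about that point, of radius smaller by `len o (c ^ n)`. Since `c` moves `o` at
linear speed, these balls contribute a convergent series.

Injectivity is proved letter by letter. Two words with the same endpoint whose first conjugators
have similar lengths have conjugators with nearby orbit points (`IsGood.dist_le_of_eq`). If one
conjugator is much longer, the geodesic to its orbit point passes near the end of the first block of
the other word (`IsGood.dist_le_of_eq_of_lt`). `exists_sparse_family` excludes both by taking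
separated subsets of very sparse shells and discarding the elements that pass by such a block. A
positive proportion of each selected shell survives, so each contributes a definite amount to the
Poincaré series at `δ / 2`, which diverges. -/

namespace Cogrowth

/-! ### Strong contraction and the detour principle -/

section Projections

variable {X : Type*} [MetricSpace X]

theorem IsGeodesicSpace.exists_dist_eq (hX : IsGeodesicSpace X) (x y : X) {t : ℝ}
    (h0 : 0 ≤ t) (h1 : t ≤ dist x y) : ∃ z, dist x z = t ∧ dist z y = dist x y - t := by
  obtain ⟨γ, h₀, h₁, hγ⟩ := hX x y
  refine ⟨γ t, ?_, ?_⟩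
  · have := hγ 0 ⟨le_rfl, h0.trans h1⟩ t ⟨h0, h1⟩
    rw [h₀] at this
    rw [this, zero_sub, abs_neg, abs_of_nonneg h0]
  · have := hγ t ⟨h0, h1⟩ (dist x y) ⟨h0.trans h1, le_rfl⟩
    rw [h₁] at this
    rw [this, abs_sub_comm, abs_of_nonneg (by linarith)]

theorem IsStronglyContractingSet.exists_dist_le {Y : Set X} (hY : IsStronglyContractingSet Y) :
    ∃ C : ℝ, 0 < C ∧ ∀ x x' q q', q ∈ closestPoints Y x → q' ∈ closestPoints Y x' →
      dist x x' ≤ dist x q → dist q q' ≤ C := by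
  obtain ⟨C, hC⟩ := hY
  -- The extra `1` makes the constant positive, so that distances can be measured in units of it.
  refine ⟨C + 1, by positivity, fun x x' q q' hq hq' h => ?_⟩
  have h1 := hC x x' (h.trans_eq hq.2)
  have h2 : edist q q' ≤ C := (Metric.edist_le_ediam_of_mem (Set.mem_union_left _ hq) (Set.mem_union_right _ hq')).trans h1
  have h3 : dist q q' ≤ C := by
    rw [edist_nndist] at h2
    exact_mod_cast h2
  linarith

/-- The closest point projection to a strongly contracting set does not increase distances by
more than an additive constant. -/
theorem dist_closestPoints_le_add (hX : IsGeodesicSpace X) {Y : Set X}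
    (hne : ∀ x, (closestPoints Y x).Nonempty) {C : ℝ} (hC0 : 0 < C)
    (hC : ∀ x x' q q', q ∈ closestPoints Y x → q' ∈ closestPoints Y x' →
      dist x x' ≤ dist x q → dist q q' ≤ C) {x x' q q' : X}
    (hq : q ∈ closestPoints Y x) (hq' : q' ∈ closestPoints Y x') :
    dist q q' ≤ dist x x' + 2 * C := by
  -- Induction on the distance in units of `C`. From a point farther than `C` from `Y`, move along
  -- the geodesic by the distance to `Y`: this uses up more than `C` of length, while the projection
  -- moves by at most `C`.
  obtain ⟨N, hN⟩ := exists_nat_ge (dist x x' / C)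
  rw [div_le_iff₀ hC0] at hN
  induction N generalizing x x' q q' with
  | zero =>
    have h0 : dist x x' ≤ dist x q := le_trans (by simpa using hN) dist_nonneg
    have := hC x x' q q' hq hq' h0
    linarith [dist_nonneg (x := x) (y := x')]
  | succ N ih =>
    push_cast at hN
    by_cases h1 : dist x q ≤ C
    · by_cases h2 : dist x' q' ≤ C
      · have := dist_triangle4 q x x' q'
        rw [dist_comm q x] at this
        linarith
      · by_cases h3 : dist x' x ≤ dist x' q'
        · have := hC x' x q' q hq' hq h3
          rw [dist_comm]
          linarith [dist_nonneg (x := x) (y := x')]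
        · push Not at h2 h3
          obtain ⟨z, hz1, hz2⟩ := hX.exists_dist_eq x' x dist_nonneg h3.le
          obtain ⟨w, hw⟩ := hne z
          have h4 := hC x' z q' w hq' hw hz1.le
          rw [dist_comm x' x] at hz2
          have h5 := ih hw hq (by linarith)
          rw [dist_comm]
          linarith [dist_triangle q' w q]
    · by_cases h3 : dist x x' ≤ dist x q
      · have := hC x x' q q' hq hq' h3
        linarith [dist_nonneg (x := x) (y := x')]
      · push Not at h1 h3
        obtain ⟨z, hz1, hz2⟩ := hX.exists_dist_eq x x' dist_nonneg h3.le
        obtain ⟨w, hw⟩ := hne z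
        have h4 := hC x z q w hq hw hz1.le
        have h5 := ih hw hq' (by linarith)
        linarith [dist_triangle q w q']

/-- `K` is a detour constant for `Y`: two points whose projections to `Y` are more than `K` apart
are, up to the error `K`, as far apart as the path through the projections is long. -/
def HasDetourConstant (Y : Set X) (K : ℝ) : Prop :=
  ∀ x y q r, q ∈ closestPoints Y x → r ∈ closestPoints Y y →
    dist q r ≤ K ∨ dist x q + dist q r + dist r y ≤ dist x y + K

/-- Cut from a geodesic its initial and final pieces of lengths `d(x, Y)` and `d(y, Y)`. Each
projects to diameter at most `C`, and the middle piece moves the projection by at most its length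
plus `2 * C`; hence `4 * C`. If the pieces overlap, the projections are `2 * C`-close. -/
theorem IsStronglyContractingSet.exists_detourConstant (hX : IsGeodesicSpace X) {Y : Set X}
    (hY : IsStronglyContractingSet Y) (hne : ∀ x, (closestPoints Y x).Nonempty) :
    ∃ K : ℝ, 0 ≤ K ∧ HasDetourConstant Y K := by
  obtain ⟨C, hC0, hC⟩ := hY.exists_dist_le
  refine ⟨4 * C, by positivity, fun x y q r hq hr => ?_⟩
  have hx0 := dist_nonneg (x := x) (y := q)
  have hy0 := dist_nonneg (x := y) (y := r)
  by_cases h1 : dist x y ≤ dist x q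
  · exact Or.inl ((hC x y q r hq hr h1).trans (by linarith))
  push Not at h1
  obtain ⟨z, hz1, hz2⟩ := hX.exists_dist_eq x y hx0 h1.le
  obtain ⟨w, hw⟩ := hne z
  have h4 := hC x z q w hq hw hz1.le
  by_cases h2 : dist y z ≤ dist y r
  · have h5 := hC y z r w hr hw h2
    left
    rw [dist_comm] at h5
    linarith [dist_triangle q w r]
  · push Not at h2
    obtain ⟨z', hz1', hz2'⟩ := hX.exists_dist_eq y z hy0 h2.le
    obtain ⟨w', hw'⟩ := hne z'
    have h5 := hC y z' r w' hr hw' hz1'.le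
    have h6 := dist_closestPoints_le_add hX hne hC0 hC hw hw'
    right
    have h7 := dist_triangle4 q w w' r
    rw [dist_comm w' r] at h7
    rw [dist_comm r y]
    rw [dist_comm z' z, dist_comm y z] at hz2'
    linarith

theorem HasDetourConstant.dist_le {Y : Set X} {K : ℝ} (hK : HasDetourConstant Y K) {x q r : X}
    (hq : q ∈ closestPoints Y x) (hr : r ∈ closestPoints Y x) : dist q r ≤ K := by
  rcases hK x x q r hq hr with h | h
  · exact h
  · rw [dist_self] at h
    linarith [dist_nonneg (x := x) (y := q), dist_nonneg (x := r) (y := x)]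

theorem mem_closestPoints_self {Y : Set X} {x : X} (hx : x ∈ Y) : x ∈ closestPoints Y x :=
  ⟨hx, by rw [dist_self, Metric.infDist_zero_of_mem hx]⟩

/-- Geodesics with endpoints in a strongly contracting set stay close to it. -/
theorem HasDetourConstant.dist_le_of_between {Y : Set X} {K : ℝ} (hK : HasDetourConstant Y K)
    (hK0 : 0 ≤ K) {x y z q : X} (hx : x ∈ Y) (hy : y ∈ Y) (hz : dist x z + dist z y = dist x y)
    (hq : q ∈ closestPoints Y z) : dist z q ≤ 2 * K := by
  have hmin : ∀ u ∈ Y, dist z q ≤ dist z u := fun u hu =>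
    hq.2.trans_le (Metric.infDist_le_dist_of_mem hu)
  have hx' := hmin x hx
  have h0 := dist_nonneg (x := z) (y := q)
  have h1 := dist_triangle x q y
  rw [dist_comm z x] at hx'
  rcases hK x z x q (mem_closestPoints_self hx) hq with h | h <;>
  rcases hK z y q y hq (mem_closestPoints_self hy) with h' | h' <;>
  linarith [hmin y hy, dist_nonneg (x := x) (y := q), dist_nonneg (x := q) (y := y),
    dist_self x, dist_self y, dist_comm q z]

end Projections

/-! ### The axis of `c`, its translates and approximate projections -/

section Axis

variable {G : Type*} [Group G] {X : Type*} [MetricSpace X] [MulAction G X]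

/-- The orbit `⟨c⟩.o`. -/
def axis (o : X) (c : G) : Set X :=
  orbitSet o (Subgroup.zpowers c : Set G)

omit [MetricSpace X] in
theorem mem_axis {o : X} {c : G} {x : X} : x ∈ axis o c ↔ ∃ n : ℤ, c ^ n • o = x := by
  simp [axis, orbitSet, Subgroup.mem_zpowers_iff]

omit [MetricSpace X] in
theorem zpow_smul_mem_axis (o : X) (c : G) (n : ℤ) : c ^ n • o ∈ axis o c :=
  mem_axis.2 ⟨n, rfl⟩

omit [MetricSpace X] in
theorem smul_mem_axis_iff {o : X} {c : G} {x : X} (n : ℤ) : c ^ n • x ∈ axis o c ↔ x ∈ axis o c := by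
  simp only [mem_axis]
  constructor
  · rintro ⟨m, hm⟩
    refine ⟨-n + m, ?_⟩
    rw [zpow_add, mul_smul, hm, ← mul_smul, ← zpow_add]
    simp
  · rintro ⟨m, hm⟩
    exact ⟨n + m, by rw [zpow_add, mul_smul, hm]⟩

theorem mem_closestPoints_iff {Y : Set X} {x q : X} :
    q ∈ closestPoints Y x ↔ q ∈ Y ∧ ∀ y ∈ Y, dist x q ≤ dist x y := by
  constructor
  · exact fun h => ⟨h.1, fun y hy => h.2.trans_le (Metric.infDist_le_dist_of_mem hy)⟩
  · exact fun h => ⟨h.1, le_antisymm ((Metric.le_infDist ⟨q, h.1⟩).2 fun {y} hy => h.2 y hy)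
      (Metric.infDist_le_dist_of_mem h.1)⟩

/-- By properness only finitely many axis points are as close to `x` as `o` is, so the minimum is
attained. -/
theorem closestPoints_axis_nonempty {o : X} (hG : IsMetricallyProper G o) (c : G) (x : X) :
    (closestPoints (axis o c) x).Nonempty := by
  have hfin : (axis o c ∩ {y | dist x y ≤ dist x o}).Finite := by
    refine ((hG x (dist x o) dist_nonneg).image fun g => g • o).subset ?_
    rintro y ⟨hy, hy'⟩
    obtain ⟨n, rfl⟩ := mem_axis.1 hy
    exact ⟨c ^ n, hy', rfl⟩
  have ho : o ∈ axis o c := mem_axis.2 ⟨0, by simp⟩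
  obtain ⟨q, hq, hmin⟩ := hfin.exists_minimalFor (fun y => dist x y) _ ⟨o, ho, le_refl (dist x o)⟩
  refine ⟨q, mem_closestPoints_iff.2 ⟨hq.1, fun y hy => ?_⟩⟩
  by_cases h : dist x y ≤ dist x o
  · rcases le_total (dist x q) (dist x y) with h' | h'
    · exact h'
    · exact hmin ⟨hy, h⟩ h'
  · exact hq.2.trans (not_le.1 h).le

variable [IsIsometricSMul G X]

theorem zpow_smul_mem_closestPoints_axis {o : X} {c : G} {x q : X} (n : ℤ) :
    c ^ n • q ∈ closestPoints (axis o c) (c ^ n • x) ↔ q ∈ closestPoints (axis o c) x := by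
  simp only [mem_closestPoints_iff, smul_mem_axis_iff, dist_smul]
  refine and_congr_right fun _ => ⟨fun h y hy => ?_, fun h y hy => ?_⟩
  · have := h (c ^ n • y) ((smul_mem_axis_iff n).2 hy)
    rwa [dist_smul] at this
  · have h1 := h (c ^ (-n) • y) ((smul_mem_axis_iff (-n)).2 hy)
    rw [← dist_smul (c ^ n) x (c ^ (-n) • y), ← mul_smul, ← zpow_add] at h1
    simpa using h1

/-- The displacement of the base point. -/
abbrev len (o : X) (g : G) : ℝ := dist o (g • o)

theorem len_inv (o : X) (g : G) : len o g⁻¹ = len o g := by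
  rw [len, ← dist_smul g, smul_inv_smul, dist_comm]

theorem dist_smul_smul_mul (o : X) (g h : G) : dist (g • o) ((g * h) • o) = len o h := by
  rw [mul_smul, dist_smul]

theorem len_mul_le (o : X) (g h : G) : len o (g * h) ≤ len o g + len o h := by
  have := dist_triangle o (g • o) ((g * h) • o)
  rwa [dist_smul_smul_mul] at this

/-- The closest points to `x` in the translate `a • axis o c` lie `k`-close to `z`. -/
def ProjNear (o : X) (c : G) (k : ℝ) (a : G) (x z : X) : Prop :=
  ∀ q, a⁻¹ • q ∈ closestPoints (axis o c) (a⁻¹ • x) → dist q z ≤ k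

variable {o : X} {c : G} {k k' l : ℝ} {a : G} {x y z z' : X}

theorem ProjNear.smul (h : ProjNear o c k a x z) (g : G) :
    ProjNear o c k (g * a) (g • x) (g • z) := by
  intro q hq
  have h1 := h (g⁻¹ • q) (by simpa [mul_smul] using hq)
  rwa [← dist_smul g, smul_inv_smul] at h1

theorem ProjNear.mul_zpow (h : ProjNear o c k a x z) (n : ℤ) : ProjNear o c k (a * c ^ n) x z := by
  intro q hq
  refine h q ?_
  rw [mul_inv_rev, mul_smul, mul_smul, ← zpow_neg, zpow_smul_mem_closestPoints_axis] at hq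
  exact hq

theorem ProjNear.zpow_smul (h : ProjNear o c k 1 x z) (n : ℤ) :
    ProjNear o c k 1 (c ^ n • x) (c ^ n • z) := by
  simpa using (h.smul (c ^ n)).mul_zpow (-n)

/-- Moving by `h * c ^ n` a point that projects close to `o`. -/
theorem ProjNear.mul_zpow_smul {v : G} (hv : ProjNear o c k 1 (v • o) o) (h : G) (n : ℤ) :
    ProjNear o c k h ((h * c ^ n * v) • o) ((h * c ^ n) • o) := by
  have := (hv.zpow_smul n).smul h
  simpa [mul_smul] using this

theorem projNear_self (o : X) (c a : G) (n : ℤ) :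
    ProjNear o c 0 a ((a * c ^ n) • o) ((a * c ^ n) • o) := by
  intro q hq
  have h1 := (mem_closestPoints_iff.1 hq).2 (c ^ n • o) (zpow_smul_mem_axis o c n)
  rw [mul_smul, inv_smul_smul, dist_self] at h1
  rw [← dist_smul a⁻¹, dist_comm, mul_smul, inv_smul_smul]
  exact h1

omit [IsIsometricSMul G X] in
theorem ProjNear.mono (h : ProjNear o c k a x z) (hk : k ≤ k') : ProjNear o c k' a x z :=
  fun q hq => (h q hq).trans hk

omit [IsIsometricSMul G X] in
theorem ProjNear.of_dist_le (h : ProjNear o c k a x z) (hk : dist z z' ≤ l) :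
    ProjNear o c (k + l) a x z' :=
  fun q hq => (dist_triangle q z z').trans (add_le_add (h q hq) hk)

theorem exists_projNear (hne : ∀ x, (closestPoints (axis o c) x).Nonempty)
    (hk : HasDetourConstant (axis o c) k) (a : G) (x : X) :
    ∃ q, a⁻¹ • q ∈ closestPoints (axis o c) (a⁻¹ • x) ∧ ProjNear o c k a x q := by
  obtain ⟨q, hq⟩ := hne (a⁻¹ • x)
  refine ⟨a • q, by simpa using hq, fun r hr => ?_⟩
  rw [← dist_smul a⁻¹, inv_smul_smul]
  exact hk.dist_le hr hq

theorem projNear_of_mem (hk : HasDetourConstant (axis o c) k) {q : X}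
    (hq : a⁻¹ • q ∈ closestPoints (axis o c) (a⁻¹ • x)) : ProjNear o c k a x q := by
  intro r hr
  rw [← dist_smul a⁻¹]
  exact hk.dist_le hr hq

/-- The detour inequality in terms of approximate projections. -/
theorem ProjNear.detour (hne : ∀ x, (closestPoints (axis o c) x).Nonempty)
    (hK : HasDetourConstant (axis o c) l)
    (hx : ProjNear o c k a x z) (hy : ProjNear o c k' a y z') (h : l + k + k' < dist z z') :
    dist x z + dist z z' + dist z' y ≤ dist x y + (l + 2 * k + 2 * k') := by
  obtain ⟨q, hq⟩ := hne (a⁻¹ • x)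
  obtain ⟨r, hr⟩ := hne (a⁻¹ • y)
  have h1 := hx (a • q) (by simpa using hq)
  have h2 := hy (a • r) (by simpa using hr)
  have h3 := dist_triangle4 z (a • q) (a • r) z'
  rw [dist_comm z (a • q)] at h3
  have h4 := dist_triangle x (a • q) z
  have h5 := dist_triangle z' (a • r) y
  rw [dist_comm z' (a • r)] at h5
  have e1 : dist (a⁻¹ • x) q = dist x (a • q) := by rw [← dist_smul a, smul_inv_smul]
  have e2 : dist r (a⁻¹ • y) = dist (a • r) y := by rw [← dist_smul a, smul_inv_smul]
  have h6 := hK _ _ q r hq hr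
  rw [dist_smul, e1, e2, ← dist_smul a q] at h6
  rcases h6 with h6 | h6 <;> linarith

end Axis

/-! ### Good elements and the geometry of words -/

section Good

variable {G : Type*} [Group G] {X : Type*} [MetricSpace X] [MulAction G X]

/-- `h.o` projects `k`-close to `o` on the axis, and `o` projects `k`-close to `h.o` on the
translate of the axis by `h`. -/
def IsGood (o : X) (c : G) (k : ℝ) (h : G) : Prop :=
  ProjNear o c k 1 (h • o) o ∧ ProjNear o c k h o (h • o)

variable [IsIsometricSMul G X] {o : X} {c : G} {k : ℝ} {h h' v v' : G}

theorem IsGood.inv (hh : IsGood o c k h) : IsGood o c k h⁻¹ :=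
  ⟨by simpa using hh.2.smul h⁻¹, by simpa using hh.1.smul h⁻¹⟩

/-- The translate of the axis by `h` has bounded projection to the axis. Otherwise the way from `h *
c ^ n` to `h` would pass near `o`, while the way from `o` to `h * c ^ n` passes near `h`; together
these bound `len o h`. -/
theorem IsGood.projNear_mul_zpow (hne : ∀ x, (closestPoints (axis o c) x).Nonempty)
    (hk : HasDetourConstant (axis o c) k) (hk0 : 0 ≤ k) (hh : IsGood o c k h)
    (hlen : 100 * k < len o h) (n : ℤ) :
    ProjNear o c (3 * k) 1 ((h * c ^ n) • o) o := by
  intro q hq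
  by_contra! hcon
  have h1 := (projNear_of_mem hk hq).detour hne hk hh.1 (by linarith)
  have h2 := dist_triangle ((h * c ^ n) • o) q o
  by_cases h3 : 2 * k < dist (h • o) ((h * c ^ n) • o)
  · have h4 := hh.2.detour hne hk (projNear_self o c h n) (by linarith)
    rw [dist_self, dist_comm (h • o)] at h4
    rw [dist_comm o ((h * c ^ n) • o)] at h4
    linarith
  · rw [dist_comm] at h3
    linarith [dist_nonneg (x := (h * c ^ n) • o) (y := o)]

theorem IsGood.projNear_zpow (hne : ∀ x, (closestPoints (axis o c) x).Nonempty)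
    (hk : HasDetourConstant (axis o c) k) (hk0 : 0 ≤ k) (hh : IsGood o c k h)
    (hlen : 100 * k < len o h) (n : ℤ) :
    ProjNear o c (3 * k) h (c ^ n • o) (h • o) := by
  have := (hh.inv.projNear_mul_zpow hne hk hk0 (by rwa [len_inv]) n).smul h
  simpa [mul_smul] using this

/-- The constant `7 * k` reproduces itself, so the bound survives induction on word length. If the
projection `q` were far from `o`, the way from the endpoint to `q` would cross the `h`-translate
from `h * c ^ n` to `h`, and the way from the endpoint to `h * c ^ n` would pass near `q`; adding
the two bounds `len o (c ^ n)`. -/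
theorem IsGood.projNear_mul_zpow_mul (hne : ∀ x, (closestPoints (axis o c) x).Nonempty)
    (hk : HasDetourConstant (axis o c) k) (hk0 : 0 ≤ k) (hh : IsGood o c k h)
    (hlen : 100 * k < len o h) {n : ℤ} (hn : 100 * k < len o (c ^ n))
    (hv : ProjNear o c (7 * k) 1 (v • o) o) :
    ProjNear o c (7 * k) 1 ((h * c ^ n * v) • o) o := by
  intro q hq
  by_contra! hcon
  have hx := hv.mul_zpow_smul h n
  obtain ⟨j, hj⟩ := mem_axis.1 hq.1
  have hq2 := hh.projNear_zpow hne hk hk0 hlen j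
  rw [hj, inv_one, one_smul] at hq2
  have h1 := hx.detour hne hk hq2 (by rw [dist_comm, dist_smul_smul_mul]; linarith)
  rw [dist_comm ((h * c ^ n) • o), dist_smul_smul_mul] at h1
  have h2 := (projNear_of_mem hk hq).detour hne hk (hh.projNear_mul_zpow hne hk hk0 hlen n)
    (by linarith)
  linarith [dist_nonneg (x := h • o) (y := q), dist_nonneg (x := o) (y := (h * c ^ n) • o),
    dist_comm ((h * c ^ n * v) • o) ((h * c ^ n) • o)]

theorem IsGood.detour (hne : ∀ x, (closestPoints (axis o c) x).Nonempty)
    (hk : HasDetourConstant (axis o c) k) (hk0 : 0 ≤ k) (hh : IsGood o c k h)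
    {n : ℤ} (hn : 100 * k < len o (c ^ n)) (hv : ProjNear o c (7 * k) 1 (v • o) o) :
    len o h + len o (c ^ n) + len o v ≤ len o (h * c ^ n * v) + 17 * k := by
  have h1 := hh.2.detour hne hk (hv.mul_zpow_smul h n) (by rw [dist_smul_smul_mul]; linarith)
  rw [dist_smul_smul_mul, dist_smul_smul_mul] at h1
  linarith

theorem projNear_one (hk0 : 0 ≤ k) : ProjNear o c k 1 ((1 : G) • o) o := by
  have := projNear_self o c 1 0
  simp only [zpow_zero, mul_one] at this
  simpa using this.mono hk0

/-- Project `h'.o` to the `h`-translate. If the projection is far from `h.o`, a geodesic from `o` to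
`h'.o` passes near `h.o`; otherwise a geodesic from `h'.o` to the endpoint does. -/
theorem IsGood.dist_le_or (hne : ∀ x, (closestPoints (axis o c) x).Nonempty)
    (hk : HasDetourConstant (axis o c) k) (hk0 : 0 ≤ k) (hh : IsGood o c k h)
    {n : ℤ} (hn : 100 * k < len o (c ^ n)) (hv : ProjNear o c (7 * k) 1 (v • o) o) {Δ : ℝ}
    (hΔ : len o h' ≤ len o h + Δ) :
    dist (h • o) (h' • o) ≤ Δ + 5 * k ∨
      dist (h • o) (h' • o) + dist (h • o) ((h * c ^ n * v) • o) ≤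
        dist (h' • o) ((h * c ^ n * v) • o) + 23 * k := by
  obtain ⟨q, -, hq⟩ := exists_projNear hne hk h (h' • o)
  by_cases h1 : 3 * k < dist (h • o) q
  · left
    have h2 := hh.2.detour hne hk hq (by linarith)
    linarith [dist_triangle (h • o) q (h' • o)]
  · right
    have h2 := hq.of_dist_le (l := 3 * k) (z' := h • o) (by rw [dist_comm]; linarith)
    have h3 := h2.detour hne hk (hv.mul_zpow_smul h n) (by rw [dist_smul_smul_mul]; linarith)
    have h4 := dist_triangle (h • o) ((h * c ^ n) • o) ((h * c ^ n * v) • o)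
    rw [dist_comm (h' • o) (h • o)] at h3
    linarith

/-- Good elements of similar length whose words reach the same point are close. -/
theorem IsGood.dist_le_of_eq (hne : ∀ x, (closestPoints (axis o c) x).Nonempty)
    (hk : HasDetourConstant (axis o c) k) (hk0 : 0 ≤ k) (hh : IsGood o c k h)
    (hh' : IsGood o c k h') {n : ℤ} (hn : 100 * k < len o (c ^ n))
    (hv : ProjNear o c (7 * k) 1 (v • o) o) (hv' : ProjNear o c (7 * k) 1 (v' • o) o) {Δ : ℝ}
    (hΔ0 : 0 ≤ Δ) (hΔ : |len o h - len o h'| ≤ Δ)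
    (heq : (h * c ^ n * v) • o = (h' * c ^ n * v') • o) :
    dist (h • o) (h' • o) ≤ Δ + 23 * k := by
  have hΔ' := abs_le.1 hΔ
  have h1 := hh.dist_le_or hne hk hk0 hn hv (h' := h') (Δ := Δ) (by linarith)
  have h2 := hh'.dist_le_or hne hk hk0 hn hv' (h' := h) (Δ := Δ) (by linarith)
  rw [heq] at h1
  rw [dist_comm (h' • o) (h • o)] at h2
  rcases h1 with h1 | h1
  · linarith
  -- If both second alternatives hold, each of the two points is nearly between the other and the
  -- common endpoint; their sum gives `2 * d ≤ 46 * k`.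
  · rcases h2 with h2 | h2 <;> linarith

/-- If words starting with good elements `h`, `h'` reach the same point and `h'` is much longer
than `h`, then a geodesic from `o` to `h'.o` passes close to the endpoint of the initial segment
`h * c ^ n * h⁻¹ * c ^ m` of the word starting with `h`. -/
theorem IsGood.dist_le_of_eq_of_lt (hne : ∀ x, (closestPoints (axis o c) x).Nonempty)
    (hk : HasDetourConstant (axis o c) k) (hk0 : 0 ≤ k) (hh : IsGood o c k h)
    (hh' : IsGood o c k h') (hlen : 100 * k < len o h) {n m : ℤ} (hn : 100 * k < len o (c ^ n))
    (hm : 100 * k < len o (c ^ m))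
    (hv : ProjNear o c (7 * k) 1 (v • o) o) (hv' : ProjNear o c (7 * k) 1 (v' • o) o)
    (hlt : len o (h * c ^ n * h⁻¹ * c ^ m) + 100 * k < len o h')
    (heq : (h * c ^ n * h⁻¹ * c ^ m * v) • o = (h' * c ^ n * v') • o) :
    len o (h * c ^ n * h⁻¹ * c ^ m) + dist ((h * c ^ n * h⁻¹ * c ^ m) • o) (h' • o) ≤
      len o h' + 35 * k := by
  set g := h * c ^ n * h⁻¹ with hg
  -- Since `g⁻¹ = h * c ^ (-n) * h⁻¹`, the previous projection bound applies to `g⁻¹`; translate it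
  -- by `g`.
  have hgo : ProjNear o c (7 * k) g o (g • o) := by
    have h1 := (hh.projNear_mul_zpow_mul hne hk hk0 hlen (n := -n) (v := h⁻¹)
      (by rwa [zpow_neg, len_inv]) (hh.inv.1.mono (by linarith))).smul g
    have h2 : g * (h * c ^ (-n) * h⁻¹) = 1 := by rw [hg]; group
    rwa [← mul_smul, h2, one_smul, mul_one] at h1
  have hgx := hv.mul_zpow_smul g m
  set x := (g * c ^ m * v) • o
  obtain ⟨q, -, hq⟩ := exists_projNear hne hk g (h' • o)
  by_cases h1 : 9 * k < dist q ((g * c ^ m) • o)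
  -- Here the way from `h'.o` to the endpoint would pass near `g * c ^ m`, and the way from `o` to
  -- the endpoint near `h'.o`; then `h'` could not be much longer than `g * c ^ m`.
  · exfalso
    have h2 := hq.detour hne hk hgx (by linarith)
    have h3 := hh'.2.detour hne hk (hv'.mul_zpow_smul h' n) (by rw [dist_smul_smul_mul]; linarith)
    rw [← heq] at h3
    linarith [dist_triangle (h' • o) q ((g * c ^ m) • o), dist_triangle o ((g * c ^ m) • o) x,
      dist_triangle (h' • o) ((h' * c ^ n) • o) x,
      dist_nonneg (x := h' • o) (y := (g * c ^ m) • o)]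
  · have h2 := hq.of_dist_le (not_lt.1 h1)
    have h3 := hgo.detour hne hk h2 (by rw [dist_smul_smul_mul]; linarith)
    linarith [dist_triangle o (g • o) ((g * c ^ m) • o)]

end Good

/-! ### Linear speed of `c` and finiteness of stabilizers -/

section Counting

variable {G : Type*} [Group G] {X : Type*} [MetricSpace X] [MulAction G X] {o : X}

theorem IsMetricallyProper.finite_len_le (hG : IsMetricallyProper G o) (r : ℝ) :
    {g : G | len o g ≤ r}.Finite := by
  rcases le_or_gt 0 r with hr | hr
  · exact hG o r hr
  · refine Set.finite_empty.subset fun g hg => ?_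
    exact absurd ((dist_nonneg (x := o) (y := g • o)).trans hg) (not_le.2 hr)

theorem IsMetricallyProper.exists_natAbs_le (hG : IsMetricallyProper G o) {c : G}
    (hc : ¬ IsOfFinOrder c) (r : ℝ) : ∃ M : ℕ, ∀ n : ℤ, len o (c ^ n) ≤ r → n.natAbs ≤ M := by
  have hfin : {n : ℤ | len o (c ^ n) ≤ r}.Finite :=
    (hG.finite_len_le r).preimage (injective_zpow_iff_not_isOfFinOrder.2 hc).injOn
  obtain ⟨M, hM⟩ := (hfin.image Int.natAbs).bddAbove
  exact ⟨M, fun n hn => hM ⟨n, hn, rfl⟩⟩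

variable [IsIsometricSMul G X]

/-- A strongly contracting element moves the base point at linear speed. -/
theorem exists_natAbs_le_mul_len (hX : IsGeodesicSpace X) (hG : IsMetricallyProper G o) {c : G}
    (hc : ¬ IsOfFinOrder c) {K : ℝ} (hK0 : 0 ≤ K) (hK : HasDetourConstant (axis o c) K) :
    ∃ M : ℝ, 0 < M ∧ ∀ n : ℤ, (n.natAbs : ℝ) ≤ M * (len o (c ^ n) + 2) := by
  -- Going back `2 * K + 1` along the geodesic from `c ^ n • o` to `o` leads within `2 * K` of an
  -- axis point `c ^ m • o`. That point is at least `1` closer to `o` and at most `4 * K + 1` from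
  -- `c ^ n • o`, so the exponent changes by at most `M`.
  obtain ⟨M, hM⟩ := hG.exists_natAbs_le hc (4 * K + 1)
  have key : ∀ k : ℕ, ∀ n : ℤ, len o (c ^ n) ≤ k → n.natAbs ≤ M * (k + 1) := by
    intro k
    induction k with
    | zero =>
      intro n hn
      simpa using hM n (hn.trans (by push_cast; linarith))
    | succ k ih =>
      intro n hn
      push_cast at hn
      rcases le_or_gt (len o (c ^ n)) (2 * K + 1) with h | h
      · exact (hM n (by linarith)).trans (Nat.le_mul_of_pos_right _ (by omega))
      · obtain ⟨z, hz1, hz2⟩ := hX.exists_dist_eq o (c ^ n • o)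
          (t := len o (c ^ n) - (2 * K + 1)) (by linarith) (by unfold len; linarith)
        obtain ⟨q, hq⟩ := closestPoints_axis_nonempty hG c z
        have hzq := hK.dist_le_of_between hK0 (x := o) (y := c ^ n • o)
          (by simpa using zpow_smul_mem_axis o c 0) (zpow_smul_mem_axis o c n)
          (by rw [hz1, hz2]; unfold len; ring) hq
        obtain ⟨m, rfl⟩ := mem_axis.1 hq.1
        have h1 := ih m (by unfold len at *; linarith [dist_triangle o z (c ^ m • o)])
        have h2 := hM (n - m) (by
          have e : len o (c ^ (n - m)) = dist (c ^ m • o) (c ^ n • o) := by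
            rw [← add_sub_cancel m n, zpow_add, dist_smul_smul_mul]
            simp
          rw [e]
          have := dist_triangle (c ^ m • o) z (c ^ n • o)
          rw [dist_comm _ z] at this
          unfold len at *
          linarith)
        have h3 : n.natAbs ≤ m.natAbs + (n - m).natAbs := by omega
        calc n.natAbs ≤ M * (k + 1) + M := by omega
          _ = M * (k + 1 + 1) := by ring
  refine ⟨M + 1, by positivity, fun n => ?_⟩
  have h1 := key ⌈len o (c ^ n)⌉₊ n (Nat.le_ceil _)
  have h2 := (Nat.ceil_lt_add_one (dist_nonneg (x := o) (y := c ^ n • o))).le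
  have h3 : (n.natAbs : ℝ) ≤ M * (⌈len o (c ^ n)⌉₊ + 1) := by exact_mod_cast h1
  have h4 : (0 : ℝ) ≤ M := by positivity
  have h5 := dist_nonneg (x := o) (y := c ^ n • o)
  unfold len at *
  nlinarith

theorem summable_exp_neg_len_zpow (hX : IsGeodesicSpace X) (hG : IsMetricallyProper G o) {c : G}
    (hc : ¬ IsOfFinOrder c) {K : ℝ} (hK0 : 0 ≤ K) (hK : HasDetourConstant (axis o c) K)
    {δ : ℝ} (hδ : 0 < δ) : Summable fun n : ℤ => Real.exp (-δ * len o (c ^ n)) := by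
  obtain ⟨M, hM0, hM⟩ := exists_natAbs_le_mul_len hX hG hc hK0 hK
  have hs : Summable fun n : ℕ => Real.exp (2 * δ) * Real.exp (n * (-(δ / M))) :=
    (Real.summable_exp_nat_mul_iff.2 (neg_lt_zero.2 (div_pos hδ hM0))).mul_left _
  have hb : ∀ n : ℤ, Real.exp (-δ * len o (c ^ n)) ≤
      Real.exp (2 * δ) * Real.exp (n.natAbs * (-(δ / M))) := by
    intro n
    rw [← Real.exp_add, Real.exp_le_exp]
    have h1 : (n.natAbs : ℝ) / M ≤ len o (c ^ n) + 2 := by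
      rw [div_le_iff₀ hM0]
      linarith [hM n]
    have h2 : (n.natAbs : ℝ) * (-(δ / M)) = -δ * (n.natAbs / M) := by ring
    rw [h2]
    nlinarith
  refine Summable.of_nat_of_neg ?_ ?_
  · exact hs.of_nonneg_of_le (fun _ => (Real.exp_pos _).le) fun n => by simpa using hb n
  · exact hs.of_nonneg_of_le (fun _ => (Real.exp_pos _).le) fun n => by simpa using hb (-n)

omit [IsIsometricSMul G X] in
-- Every fibre of the orbit map is a translate of part of the stabilizer of `o`, which is finite.
theorem IsMetricallyProper.ncard_le_mul_ncard_orbitSet (hG : IsMetricallyProper G o) {A : Set G}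
    (hA : A.Finite) : A.ncard ≤ {g : G | len o g ≤ 0}.ncard * (orbitSet o A).ncard := by
  classical
  lift A to Finset G using hA
  have h1 : orbitSet o (A : Set G) = (A.image fun g => g • o : Finset X) := by
    simp [orbitSet]
  rw [h1, Set.ncard_coe_finset, Set.ncard_coe_finset]
  refine Finset.card_le_mul_card_image A _ fun x _ => ?_
  by_cases hx : ∃ g : G, g • o = x
  · obtain ⟨g, rfl⟩ := hx
    rw [← Set.ncard_coe_finset]
    refine Set.ncard_le_ncard_of_injOn (fun y => g⁻¹ * y) ?_ (mul_right_injective _).injOn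
      (hG.finite_len_le 0)
    intro y hy
    have hy' : y • o = g • o := (Finset.mem_filter.1 hy).2
    simp [len, mul_smul, hy']
  · have : (A.filter fun g => g • o = x) = ∅ :=
      Finset.filter_eq_empty_iff.2 fun g _ hg => hx ⟨g, hg⟩
    simp [this]

end Counting

/-! ### Counting group elements and good elements -/

section GoodCounting

variable {G : Type*} [Group G] {X : Type*} [MetricSpace X] [MulAction G X] {o : X}

/-- The group elements whose displacement lies in `[r, r + Δ)`. -/
def lenShell (G : Type*) [Group G] [MulAction G X] (o : X) (r Δ : ℝ) : Set G :=
  {g | r ≤ len o g ∧ len o g < r + Δ}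

theorem orbitSet_lenShell (r Δ : ℝ) :
    orbitSet o (lenShell G o r Δ) = orbitSet o (Set.univ : Set G) ∩ shell o r Δ := by
  ext x
  simp only [orbitSet, lenShell, shell, Set.mem_image, Set.mem_ofPred_eq, Set.mem_inter_iff,
    Set.mem_univ, true_and, Set.mem_sdiff, Metric.mem_ball, not_lt, len]
  constructor
  · rintro ⟨g, ⟨h1, h2⟩, rfl⟩
    rw [dist_comm o] at h1 h2
    exact ⟨⟨g, rfl⟩, h2, h1⟩
  · rintro ⟨⟨g, rfl⟩, h2, h1⟩
    rw [dist_comm _ o] at h1 h2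
    exact ⟨g, ⟨h1, h2⟩, rfl⟩

theorem IsMetricallyProper.finite_len_lt (hG : IsMetricallyProper G o) (r : ℝ) :
    {g : G | len o g < r}.Finite :=
  (hG.finite_len_le r).subset fun g (hg : len o g < r) => hg.le

theorem IsMetricallyProper.finite_lenShell (hG : IsMetricallyProper G o) (r Δ : ℝ) :
    (lenShell G o r Δ).Finite :=
  (hG.finite_len_le (r + Δ)).subset fun _ hg => hg.2.le

/-- Purely exponential growth of the orbit, in terms of group elements. -/
theorem exists_growth_bounds (hG : IsMetricallyProper G o)
    (hgrowth : HasPurelyExponentialGrowth o (orbitSet o (Set.univ : Set G))) :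
    ∃ δ : ℝ, 0 < δ ∧ ∃ Δ : ℝ, 0 < Δ ∧ ∃ a : ℝ, 0 < a ∧ ∃ C : ℝ, 0 < C ∧
      (∀ r : ℝ, 0 ≤ r → a * Real.exp (δ * r) ≤ (orbitSet o (lenShell G o r Δ)).ncard) ∧
      ∀ r : ℝ, ({g : G | len o g ≤ r}.ncard : ℝ) ≤ C * Real.exp (δ * r) := by
  obtain ⟨δ, hδ, Δ, hΔ, C, hC, h⟩ := hgrowth
  refine ⟨δ, hδ, Δ, hΔ, C⁻¹, inv_pos.2 hC, ?_⟩
  set s : ℕ := {g : G | len o g ≤ 0}.ncard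
  set M : ℝ := s * C with hM
  have hM0 : 0 ≤ M := by positivity
  have hshell : ∀ r : ℝ, 0 ≤ r → ((lenShell G o r Δ).ncard : ℝ) ≤ M * Real.exp (δ * r) := by
    intro r hr
    have h1 := hG.ncard_le_mul_ncard_orbitSet (hG.finite_lenShell r Δ)
    rw [orbitSet_lenShell] at h1
    have h2 : ((lenShell G o r Δ).ncard : ℝ) ≤
        s * ((orbitSet o (Set.univ : Set G) ∩ shell o r Δ).ncard : ℝ) := by exact_mod_cast h1
    refine h2.trans ?_
    rw [hM, mul_assoc]
    exact mul_le_mul_of_nonneg_left (h r hr).2.2 (by positivity)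
  have hE : 0 < Real.exp (δ * Δ) - 1 := by
    have := Real.add_one_lt_exp (mul_pos hδ hΔ).ne'
    linarith [mul_pos hδ hΔ]
  -- Chosen so that adding one shell, at most `M * exp (δ k Δ)`, turns the bound for `k` exactly
  -- into that for `k + 1`.
  set M' : ℝ := M / (Real.exp (δ * Δ) - 1) with hM'
  have hM'0 : 0 ≤ M' := by positivity
  have hball : ∀ k : ℕ, ({g : G | len o g < k * Δ}.ncard : ℝ) ≤
      M' * Real.exp (δ * (k * Δ)) := by
    intro k
    induction k with
    | zero =>
      have : {g : G | len o g < (0 : ℕ) * Δ} = ∅ :=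
        Set.eq_empty_iff_forall_notMem.2 fun g hg => by
          simp only [Nat.cast_zero, zero_mul, Set.mem_ofPred_eq] at hg
          exact absurd hg (not_lt.2 dist_nonneg)
      rw [this, Set.ncard_empty, Nat.cast_zero]
      positivity
    | succ k ih =>
      have hsub : {g : G | len o g < (k + 1 : ℕ) * Δ} ⊆
          {g : G | len o g < k * Δ} ∪ lenShell G o (k * Δ) Δ := by
        intro g hg
        rcases lt_or_ge (len o g) (k * Δ) with h1 | h1
        · exact Or.inl h1
        · refine Or.inr ⟨h1, ?_⟩
          have : len o g < (k + 1 : ℕ) * Δ := hg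
          push_cast at this
          linarith
      have hfin : ({g : G | len o g < k * Δ} ∪ lenShell G o (k * Δ) Δ).Finite :=
        (hG.finite_len_lt _).union (hG.finite_lenShell _ _)
      have h1 := (Set.ncard_le_ncard hsub hfin).trans (Set.ncard_union_le _ _)
      have h2 : ({g : G | len o g < (k + 1 : ℕ) * Δ}.ncard : ℝ) ≤
          ({g : G | len o g < k * Δ}.ncard : ℝ) + ((lenShell G o (k * Δ) Δ).ncard : ℝ) := by
        exact_mod_cast h1
      have h3 := hshell (k * Δ) (by positivity)
      have h4 : M' * Real.exp (δ * ((k + 1 : ℕ) * Δ)) =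
          M' * Real.exp (δ * (k * Δ)) + M * Real.exp (δ * (k * Δ)) := by
        have h5 : M' * (Real.exp (δ * Δ) - 1) = M := div_mul_cancel₀ _ hE.ne'
        have h6 : δ * ((k + 1 : ℕ) * Δ) = δ * (k * Δ) + δ * Δ := by push_cast; ring
        rw [h6, Real.exp_add, ← h5]
        ring
      linarith
  refine ⟨M' * Real.exp (δ * Δ) + 1, by positivity, fun r hr => ?_, fun r => ?_⟩
  · rw [orbitSet_lenShell, inv_mul_eq_div]
    exact (h r hr).2.1
  · rcases lt_or_ge r 0 with hr | hr
    · have : {g : G | len o g ≤ r} = ∅ :=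
        Set.eq_empty_iff_forall_notMem.2 fun g hg =>
          absurd ((dist_nonneg (x := o) (y := g • o)).trans hg) (not_le.2 hr)
      rw [this, Set.ncard_empty, Nat.cast_zero]
      positivity
    · have h1 := Nat.lt_floor_add_one (r / Δ)
      have h2 := Nat.floor_le (div_nonneg hr hΔ.le)
      rw [div_lt_iff₀ hΔ] at h1
      rw [le_div_iff₀ hΔ] at h2
      have hsub : {g : G | len o g ≤ r} ⊆ {g : G | len o g < (⌊r / Δ⌋₊ + 1 : ℕ) * Δ} := by
        intro g hg
        have hg' : len o g ≤ r := hg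
        change len o g < _
        push_cast
        linarith
      have h3 := Set.ncard_le_ncard hsub
        (hG.finite_len_lt _)
      have h4 : ({g : G | len o g ≤ r}.ncard : ℝ) ≤
          ({g : G | len o g < (⌊r / Δ⌋₊ + 1 : ℕ) * Δ}.ncard : ℝ) := by exact_mod_cast h3
      refine (h4.trans (hball _)).trans ?_
      have h5 : Real.exp (δ * ((⌊r / Δ⌋₊ + 1 : ℕ) * Δ)) ≤ Real.exp (δ * Δ) * Real.exp (δ * r) := by
        rw [← Real.exp_add, Real.exp_le_exp]
        push_cast
        nlinarith
      nlinarith [mul_le_mul_of_nonneg_left h5 hM'0, Real.exp_pos (δ * r)]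

/-- Cardinality of a finite union of left translates of balls. -/
theorem ncard_le_sum_of_subset_iUnion {ι : Type*} (T : Finset ι) {A : Set G} {t : ι → G}
    {ρ : ι → ℝ} (hG : IsMetricallyProper G o) {δ C : ℝ}
    (hC : ∀ r : ℝ, ({g : G | len o g ≤ r}.ncard : ℝ) ≤ C * Real.exp (δ * r))
    (h : ∀ g ∈ A, ∃ i ∈ T, len o ((t i)⁻¹ * g) ≤ ρ i) :
    (A.ncard : ℝ) ≤ ∑ i ∈ T, C * Real.exp (δ * ρ i) := by
  classical
  set B : ι → Finset G := fun i =>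
    (hG.finite_len_le (ρ i)).toFinset.image fun u => t i * u
  have hsub : A ⊆ (T.biUnion B : Finset G) := by
    intro g hg
    obtain ⟨i, hi, hgi⟩ := h g hg
    simp only [Finset.coe_biUnion, Set.mem_iUnion, SetLike.mem_coe]
    refine ⟨i, hi, Finset.mem_image.2 ⟨(t i)⁻¹ * g, by simpa using hgi, by simp⟩⟩
  have h1 := Set.ncard_le_ncard hsub (Finset.finite_toSet _)
  rw [Set.ncard_coe_finset] at h1
  have h2 : (A.ncard : ℝ) ≤ ∑ i ∈ T, ((B i).card : ℝ) := by
    exact_mod_cast h1.trans Finset.card_biUnion_le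
  refine h2.trans (Finset.sum_le_sum fun i _ => le_trans ?_ (hC (ρ i)))
  rw [Set.ncard_eq_toFinset_card _ (hG.finite_len_le (ρ i))]
  exact_mod_cast Finset.card_image_le

variable [IsIsometricSMul G X]

/-- A definite proportion of the group elements of given length is good. -/
theorem exists_isGood_growth (hX : IsGeodesicSpace X) (hG : IsMetricallyProper G o) {c : G}
    (hc : ¬ IsOfFinOrder c) {K : ℝ} (hK0 : 0 ≤ K) (hK : HasDetourConstant (axis o c) K)
    {δ Δ a C : ℝ} (hδ : 0 < δ) (ha : 0 < a) (hC0 : 0 < C)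
    (hlow : ∀ r : ℝ, 0 ≤ r → a * Real.exp (δ * r) ≤ (lenShell G o r Δ).ncard)
    (hC : ∀ r : ℝ, ({g : G | len o g ≤ r}.ncard : ℝ) ≤ C * Real.exp (δ * r)) :
    ∃ k : ℝ, K ≤ k ∧ ∀ r : ℝ, 0 ≤ r → a / 2 * Real.exp (δ * r) ≤
      {g ∈ lenShell G o r Δ | IsGood o c k g}.ncard := by
  set D : ℝ := C * Real.exp (δ * (Δ + K)) with hD
  have hD0 : 0 < D := by positivity
  -- Taking `k` at least every `len o (c ^ n)` with `n ∈ s` puts the exponents of all bad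
  -- projections in the small tail of the series.
  obtain ⟨s, hs⟩ := summable_iff_vanishing_norm.1
    (summable_exp_neg_len_zpow hX hG hc hK0 hK hδ) (a / (4 * D)) (by positivity)
  obtain ⟨k₀, hk₀⟩ := (s.finite_toSet.image fun n : ℤ => len o (c ^ n)).bddAbove
  set k := max K k₀
  refine ⟨k, le_max_left _ _, fun r hr => ?_⟩
  set L : Set G := {g ∈ lenShell G o r Δ | ¬ ProjNear o c k 1 (g • o) o}
  have hne := closestPoints_axis_nonempty hG c
  have hL : (L.ncard : ℝ) ≤ a / 4 * Real.exp (δ * r) := by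
    have hTfin : {n : ℤ | k < len o (c ^ n) ∧ len o (c ^ n) ≤ r + Δ + K}.Finite :=
      ((hG.finite_len_le (r + Δ + K)).preimage
        (injective_zpow_iff_not_isOfFinOrder.2 hc).injOn).subset fun n hn => hn.2
    have h1 := ncard_le_sum_of_subset_iUnion hTfin.toFinset (A := L) (t := fun n => c ^ n)
      (ρ := fun n => r + Δ + K - len o (c ^ n)) hG hC (by
        rintro g ⟨⟨-, hgΔ⟩, hg⟩
        unfold ProjNear at hg
        push Not at hg
        obtain ⟨q, hq, hqk⟩ := hg
        simp only [inv_one, one_smul] at hq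
        obtain ⟨n, rfl⟩ := mem_axis.1 hq.1
        have h2 : o ∈ closestPoints (axis o c) o :=
          mem_closestPoints_self (by simpa using zpow_smul_mem_axis o c 0)
        have h3 : len o ((c ^ n)⁻¹ * g) = dist (c ^ n • o) (g • o) := by
          rw [← dist_smul_smul_mul, mul_inv_cancel_left]
        have h4 : len o (c ^ n) = dist o (c ^ n • o) := rfl
        rw [dist_comm, ← h4] at hqk
        rcases hK o (g • o) o (c ^ n • o) h2 hq with h5 | h5
        · rw [← h4] at h5
          linarith [le_max_left K k₀]
        · rw [← h4, ← h3, dist_self] at h5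
          have h6 : dist o (g • o) = len o g := rfl
          refine ⟨n, hTfin.mem_toFinset.2 ⟨hqk, ?_⟩, ?_⟩
          · linarith [dist_nonneg (x := o) (y := ((c ^ n)⁻¹ * g) • o)]
          · linarith)
    have h2 : Disjoint hTfin.toFinset s := by
      refine Finset.disjoint_left.2 fun n hn hns => ?_
      have h3 := (hTfin.mem_toFinset.1 hn).1
      have h4 := hk₀ ⟨n, hns, rfl⟩
      have h5 := le_max_right K k₀
      exact absurd h3 (not_lt.2 (h4.trans h5))
    have h3 := (le_abs_self _).trans_lt (hs _ h2)
    refine h1.trans ?_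
    have h4 : ∑ n ∈ hTfin.toFinset, C * Real.exp (δ * (r + Δ + K - len o (c ^ n))) =
        D * Real.exp (δ * r) * ∑ n ∈ hTfin.toFinset, Real.exp (-δ * len o (c ^ n)) := by
      rw [Finset.mul_sum]
      refine Finset.sum_congr rfl fun n _ => ?_
      rw [hD, mul_assoc, mul_assoc, ← Real.exp_add, ← Real.exp_add]
      congr 2
      ring
    rw [h4]
    calc _ ≤ D * Real.exp (δ * r) * (a / (4 * D)) :=
          mul_le_mul_of_nonneg_left h3.le (by positivity)
      _ = a / 4 * Real.exp (δ * r) := by field_simp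
  have hfin := hG.finite_lenShell r Δ
  have hLfin : L.Finite := hfin.subset fun _ hg => hg.1
  -- Failure of the second half of goodness for `g` is failure of the first half for `g⁻¹`, so two
  -- copies of `L` suffice.
  have hsub : lenShell G o r Δ ⊆
      {g ∈ lenShell G o r Δ | IsGood o c k g} ∪ (L ∪ (fun g => g⁻¹) '' L) := by
    intro g hg
    by_cases h1 : ProjNear o c k 1 (g • o) o
    · by_cases h2 : ProjNear o c k 1 (g⁻¹ • o) o
      · exact Or.inl ⟨hg, h1, by simpa using h2.smul g⟩
      · refine Or.inr (Or.inr ⟨g⁻¹, ⟨?_, h2⟩, inv_inv g⟩)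
        simpa [lenShell, len_inv] using hg
    · exact Or.inr (Or.inl ⟨hg, h1⟩)
  have h1 := Set.ncard_le_ncard hsub
    ((hfin.subset fun _ hg => hg.1).union (hLfin.union (hLfin.image _)))
  have h2 := h1.trans (Set.ncard_union_le _ _)
  have h3 := h2.trans (Nat.add_le_add_left (Set.ncard_union_le _ _) _)
  rw [Set.ncard_image_of_injective _ inv_injective] at h3
  have h4 : ((lenShell G o r Δ).ncard : ℝ) ≤
      ({g ∈ lenShell G o r Δ | IsGood o c k g}.ncard : ℝ) + (L.ncard + L.ncard) := by
    exact_mod_cast h3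
  linarith [hlow r hr]

end GoodCounting

/-! ### Selecting a sparse separated family -/

section Selection

theorem sum_exp_neg_mul_three_pow_le {q t : ℝ} (hq : Real.exp (-t) = q) (ht : 0 ≤ t)
    (hq2 : q ≤ 1 / 2) (i : ℕ) :
    ∑ j ∈ Finset.range i, Real.exp (-(t * 3 ^ j)) ≤ 2 * q := by
  have hq0 : 0 < q := hq ▸ Real.exp_pos _
  have h1 : ∀ i : ℕ, ∑ j ∈ Finset.range i, q ^ j ≤ 2 - 2 * q ^ i := by
    intro i
    induction i with
    | zero => simp
    | succ i ih =>
      rw [Finset.sum_range_succ, pow_succ]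
      nlinarith [pow_pos hq0 i]
  have h2 : ∀ j : ℕ, Real.exp (-(t * 3 ^ j)) ≤ q * q ^ j := by
    intro j
    rw [← pow_succ', ← hq, ← Real.exp_nat_mul, Real.exp_le_exp]
    have h3 : ((j + 1 : ℕ) : ℝ) ≤ 3 ^ j := by
      exact_mod_cast Nat.succ_le_of_lt (Nat.lt_pow_self (by norm_num))
    nlinarith
  refine (Finset.sum_le_sum fun j _ => h2 j).trans ?_
  rw [← Finset.mul_sum]
  nlinarith [h1 i, pow_pos hq0 i]

variable {G : Type*} [Group G] {X : Type*} [MetricSpace X] [MulAction G X]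
  [IsIsometricSMul G X] {o : X}

/-- Every finite set of group elements contains a definite proportion whose orbit points are
pairwise far apart. -/
theorem exists_separated_subset (hG : IsMetricallyProper G o) {δ C : ℝ}
    (hC : ∀ r : ℝ, ({g : G | len o g ≤ r}.ncard : ℝ) ≤ C * Real.exp (δ * r))
    {D : ℝ} (hD : 0 ≤ D) {A : Set G} (hA : A.Finite) :
    ∃ S ⊆ A, (∀ g ∈ S, ∀ h ∈ S, dist (g • o) (h • o) ≤ D → g = h) ∧
      (A.ncard : ℝ) ≤ S.ncard * (C * Real.exp (δ * D)) := by
  classical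
  lift A to Finset G using hA
  -- By maximality, the `D`-balls about the points of `S` cover `A`.
  obtain ⟨S, hS, hmax⟩ := Finset.exists_max_image
    (A.powerset.filter fun S => ∀ g ∈ S, ∀ h ∈ S, dist (g • o) (h • o) ≤ D → g = h) Finset.card
    ⟨∅, by simp⟩
  rw [Finset.mem_filter, Finset.mem_powerset] at hS
  refine ⟨S, by exact_mod_cast hS.1, by exact_mod_cast hS.2, ?_⟩
  have h1 := ncard_le_sum_of_subset_iUnion S (A := (A : Set G)) (t := id) (ρ := fun _ => D) hG hC
    (by
      intro g hg
      by_contra! hcon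
      have hcon' : ∀ s ∈ S, D < dist (s • o) (g • o) := by
        intro s hs
        have h2 := hcon s hs
        rwa [← dist_smul_smul_mul o s, id, mul_inv_cancel_left] at h2
      have hgS : g ∉ S := fun h => by
        have h2 := hcon' g h
        rw [dist_self] at h2
        exact absurd hD (not_le.2 h2)
      have h3 := hmax (insert g S) (by
        rw [Finset.mem_filter, Finset.mem_powerset]
        refine ⟨Finset.insert_subset hg hS.1, ?_⟩
        intro x hx y hy hxy
        rcases Finset.mem_insert.1 hx with rfl | hx' <;>
          rcases Finset.mem_insert.1 hy with rfl | hy'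
        · rfl
        · rw [dist_comm] at hxy
          exact absurd hxy (not_le.2 (hcon' y hy'))
        · exact absurd hxy (not_le.2 (hcon' x hx'))
        · exact hS.2 x hx' y hy' hxy)
      rw [Finset.card_insert_of_notMem hgS] at h3
      omega)
  rw [Finset.sum_const, nsmul_eq_mul] at h1
  rwa [Set.ncard_coe_finset S]

/-- From a set of group elements of positive density, select separated subsets of sparse shells,
so that no selected element passes by `b h` for a shorter `h` of the set. -/
theorem exists_sparse_family (hG : IsMetricallyProper G o) {δ Δ a C : ℝ} (hδ : 0 < δ)
    (ha : 0 < a) (hC0 : 0 < C)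
    (hC : ∀ r : ℝ, ({g : G | len o g ≤ r}.ncard : ℝ) ≤ C * Real.exp (δ * r))
    {P : G → Prop} (hP : ∀ r : ℝ, 0 ≤ r → a * Real.exp (δ * r) ≤
      {g ∈ lenShell G o r Δ | P g}.ncard)
    (b : G → G) {B κ D : ℝ} (hD : 0 ≤ D)
    (hb : ∀ h, P h → B ≤ len o h → 2 * len o h - B ≤ len o (b h)) :
    ∃ (S : ℕ → Set G) (r : ℕ → ℝ) (a' : ℝ), 0 < a' ∧ (∀ i : ℕ, (i : ℝ) ≤ r i) ∧
      (∀ i, B ≤ r i) ∧ (∀ j i, j < i → 2 * r j + B ≤ r i) ∧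
      (∀ i, S i ⊆ {g ∈ lenShell G o (r i) Δ | P g}) ∧
      (∀ i, a' * Real.exp (δ * r i) ≤ (S i).ncard) ∧
      (∀ i, ∀ g ∈ S i, ∀ h ∈ S i, dist (g • o) (h • o) ≤ D → g = h) ∧
      ∀ j i, j < i → ∀ h ∈ S j, ∀ h' ∈ S i,
        len o h' + κ < len o (b h) + dist (b h • o) (h' • o) := by
  set E : ℝ := C * C * Real.exp (δ * (2 * Δ + κ + B)) with hE
  have hE0 : 0 < E := by positivity
  have hlim : Filter.Tendsto (fun R : ℝ => Real.exp (-(δ * R))) Filter.atTop (nhds 0) :=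
    Real.tendsto_exp_neg_atTop_nhds_zero.comp (Filter.tendsto_id.const_mul_atTop hδ)
  obtain ⟨R, hRq, hR⟩ := ((hlim.eventually (gt_mem_nhds
    (show (0 : ℝ) < min (1 / 2) (a / (4 * E)) by positivity))).and
    (Filter.eventually_ge_atTop (max B 1))).exists
  have hRB : B ≤ R := (le_max_left _ _).trans hR
  have hR1 : 1 ≤ R := (le_max_right _ _).trans hR
  set q := Real.exp (-(δ * R)) with hq
  have hq2 : q ≤ 1 / 2 := hRq.le.trans (min_le_left _ _)
  have hqE : 2 * q * E ≤ a / 2 := by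
    have h1 := hRq.le.trans (min_le_right _ _)
    rw [le_div_iff₀ (by positivity)] at h1
    linarith
  set r : ℕ → ℝ := fun i => R * 3 ^ i with hr
  have hpow : ∀ i : ℕ, (1 : ℝ) ≤ 3 ^ i := fun i => one_le_pow₀ (by norm_num)
  have hrR : ∀ i, R ≤ r i := fun i => by
    have := hpow i
    simp only [hr]
    nlinarith
  set A : ℕ → Set G := fun i => {g ∈ lenShell G o (r i) Δ | P g} with hA
  have hAfin : ∀ i, (A i).Finite := fun i => (hG.finite_lenShell (r i) Δ).subset fun _ h => h.1
  -- Each `h` at level `j` spoils a ball of radius about `r i - 2 * r j`, and there are about `exp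
  -- (δ * r j)` such `h`. Level `j` thus spoils a fraction of order `exp (-δ * r j)`, and with `r j
  -- = R * 3 ^ j` these fractions have a small sum once `R` is large.
  set F : ℕ → Set G := fun i => {h' ∈ A i | ∃ j < i, ∃ h ∈ A j,
    len o (b h) + dist (b h • o) (h' • o) ≤ len o h' + κ} with hF
  have hFcard : ∀ i, ((F i).ncard : ℝ) ≤ a / 2 * Real.exp (δ * r i) := by
    intro i
    have h1 := ncard_le_sum_of_subset_iUnion
      ((Finset.range i).sigma fun j => (hAfin j).toFinset) (A := F i) (t := fun p => b p.2)
      (ρ := fun p => r i + Δ + κ + B - 2 * r p.1) hG hC (by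
        rintro h' ⟨hh', j, hj, h, hh, hle⟩
        refine ⟨⟨j, h⟩, by simpa using ⟨hj, hh⟩, ?_⟩
        have h2 := hb h hh.2 ((hRB.trans (hrR j)).trans hh.1.1)
        have h3 : len o ((b h)⁻¹ * h') = dist (b h • o) (h' • o) := by
          rw [← dist_smul_smul_mul, mul_inv_cancel_left]
        have h4 := hh'.1.2
        have h5 := hh.1.1
        change len o ((b h)⁻¹ * h') ≤ r i + Δ + κ + B - 2 * r j
        linarith)
    rw [Finset.sum_sigma] at h1
    refine h1.trans ?_
    have h2 : ∀ j ∈ Finset.range i, ∑ h ∈ (hAfin j).toFinset,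
        C * Real.exp (δ * (r i + Δ + κ + B - 2 * r j)) ≤
        E * Real.exp (δ * r i) * Real.exp (-(δ * R * 3 ^ j)) := by
      intro j _
      rw [Finset.sum_const, nsmul_eq_mul, ← Set.ncard_eq_toFinset_card _ (hAfin j)]
      have h3 : ((A j).ncard : ℝ) ≤ C * Real.exp (δ * (r j + Δ)) := by
        refine le_trans ?_ (hC (r j + Δ))
        exact_mod_cast Set.ncard_le_ncard (fun g (hg : g ∈ A j) => hg.1.2.le) (hG.finite_len_le _)
      refine (mul_le_mul_of_nonneg_right h3 (by positivity)).trans (le_of_eq ?_)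
      rw [hE, mul_mul_mul_comm, ← Real.exp_add, mul_assoc (C * C), ← Real.exp_add,
        mul_assoc (C * C), ← Real.exp_add]
      congr 2
      simp only [hr]
      ring
    refine (Finset.sum_le_sum h2).trans ?_
    rw [← Finset.mul_sum]
    have h3 := sum_exp_neg_mul_three_pow_le hq.symm (by positivity) hq2 i
    calc _ ≤ E * Real.exp (δ * r i) * (2 * q) := mul_le_mul_of_nonneg_left h3 (by positivity)
      _ = 2 * q * E * Real.exp (δ * r i) := by ring
      _ ≤ _ := mul_le_mul_of_nonneg_right hqE (by positivity)
  have hsep := fun i => exists_separated_subset hG hC hD ((hAfin i).subset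
    (Set.sdiff_subset : A i \ F i ⊆ A i))
  choose S hSA hSsep hScard using hsep
  refine ⟨S, r, a / 2 / (C * Real.exp (δ * D)), by positivity, fun i => ?_,
    fun i => hRB.trans (hrR i), fun j i hji => ?_, fun i g hg => (hSA i hg).1, fun i => ?_, hSsep,
    fun j i hji h hh h' hh' => ?_⟩
  · have h1 : (i : ℝ) ≤ 3 ^ i := by
      exact_mod_cast (Nat.lt_pow_self (by norm_num)).le
    simp only [hr]
    nlinarith [hpow i]
  · have h1 : (3 : ℝ) ^ (j + 1) ≤ 3 ^ i := pow_le_pow_right₀ (by norm_num) hji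
    have h2 := hpow j
    simp only [hr]
    rw [pow_succ] at h1
    nlinarith
  · rw [div_mul_eq_mul_div, div_le_iff₀ (by positivity)]
    refine le_trans ?_ (hScard i)
    have h1 := Set.le_ncard_sdiff (F i) (A i) ((hAfin i).subset fun _ h => h.1)
    have h2 : ((A i).ncard : ℝ) - (F i).ncard ≤ ((A i \ F i).ncard : ℝ) := by
      have : (A i).ncard ≤ (A i \ F i).ncard + (F i).ncard := by omega
      have : ((A i).ncard : ℝ) ≤ (A i \ F i).ncard + (F i).ncard := by exact_mod_cast this
      linarith
    have h3 := hP (r i) (by linarith [hrR i])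
    linarith [hFcard i]
  · by_contra! hcon
    exact (hSA i hh').2 ⟨(hSA i hh').1, j, hji, h, (hSA j hh).1, hcon⟩

end Selection

/-! ### Growth rates and Poincaré series from counting bounds -/

section GrowthRate

variable {X : Type*} [MetricSpace X] {o : X} {Y : Set X}

theorem tendsto_log_mul_exp_div (s : ℝ) {C : ℝ} (hC : 0 < C) {ι : Type*} {l : Filter ι}
    {ρ : ι → ℝ} (hρ : Filter.Tendsto ρ l Filter.atTop) :
    Filter.Tendsto (fun i => ((Real.log (C * Real.exp (s * ρ i)) / ρ i : ℝ) : EReal)) l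
      (nhds (s : EReal)) := by
  refine (continuous_coe_real_ereal.tendsto s).comp ?_
  have h1 : Filter.Tendsto (fun i => Real.log C / ρ i + s) l (nhds (0 + s)) :=
    (hρ.const_div_atTop _).add_const s
  rw [zero_add] at h1
  refine h1.congr' ?_
  filter_upwards [hρ.eventually (Filter.eventually_gt_atTop 0)] with i hi
  rw [Real.log_mul hC.ne' (Real.exp_pos _).ne', Real.log_exp]
  field_simp

theorem growthRate_le {s C : ℝ} (hC : 0 < C) (hfin : ∀ r, (Y ∩ Metric.closedBall o r).Finite)
    (hY : ∀ r, ((Y ∩ Metric.closedBall o r).ncard : ℝ) ≤ C * Real.exp (s * r)) :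
    growthRate o Y ≤ s := by
  rw [← (tendsto_log_mul_exp_div s hC Filter.tendsto_id).limsup_eq]
  refine Filter.limsup_le_limsup ?_
  filter_upwards [Filter.eventually_gt_atTop (0 : ℝ)] with r hr
  rw [EReal.coe_div]
  refine EReal.div_le_div_right_of_nonneg (by exact_mod_cast hr.le) ?_
  rw [← ENNReal.log_ofReal_of_pos (by positivity)]
  refine ENNReal.log_monotone ?_
  rw [← (hfin r).cast_ncard_eq]
  have h1 : (((Y ∩ Metric.closedBall o r).ncard : ℕ∞) : ℝ≥0∞) =
      ENNReal.ofReal ((Y ∩ Metric.closedBall o r).ncard : ℝ) := by simp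
  rw [h1]
  exact ENNReal.ofReal_le_ofReal (hY r)

theorem le_growthRate {s a : ℝ} (ha : 0 < a) {ρ : ℕ → ℝ}
    (hρ : Filter.Tendsto ρ Filter.atTop Filter.atTop) (T : ℕ → Set X)
    (hT : ∀ i, T i ⊆ Y ∩ Metric.closedBall o (ρ i))
    (hcard : ∀ i, a * Real.exp (s * ρ i) ≤ (T i).ncard) :
    (s : EReal) ≤ growthRate o Y := by
  rw [← (tendsto_log_mul_exp_div s ha hρ).limsup_eq]
  refine le_trans ?_ (Filter.limsup_le_limsup_of_le hρ)
  change _ ≤ Filter.limsup (fun i => ENNReal.log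
    ((Y ∩ Metric.closedBall o (ρ i)).encard : ℝ≥0∞) / (ρ i : EReal)) Filter.atTop
  refine Filter.limsup_le_limsup ?_
  filter_upwards [hρ.eventually (Filter.eventually_gt_atTop 0)] with i hi
  rw [EReal.coe_div]
  refine EReal.div_le_div_right_of_nonneg (by exact_mod_cast hi.le) ?_
  rw [← ENNReal.log_ofReal_of_pos (by positivity)]
  refine ENNReal.log_monotone ((ENNReal.ofReal_le_ofReal (hcard i)).trans ?_)
  have h1 : ((T i).ncard : ℕ∞) ≤ (Y ∩ Metric.closedBall o (ρ i)).encard :=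
    (ENat.natCast_toNat_le_self _).trans (Set.encard_le_encard (hT i))
  calc ENNReal.ofReal ((T i).ncard : ℝ) = (((T i).ncard : ℕ∞) : ℝ≥0∞) := by simp
    _ ≤ _ := by exact_mod_cast h1

/-- Each of the infinitely many disjoint sets `T i` contributes at least `a` to the series. -/
theorem poincareSeries_eq_top {s a : ℝ} (hs : 0 ≤ s) (ha : 0 < a) {ρ : ℕ → ℝ} (T : ℕ → Set X)
    (hT : ∀ i, T i ⊆ Y ∩ Metric.closedBall o (ρ i)) (hdisj : ∀ i j x, x ∈ T i → x ∈ T j → i = j)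
    (hfin : ∀ i, (T i).Finite) (hcard : ∀ i, a * Real.exp (s * ρ i) ≤ (T i).ncard) :
    poincareSeries o Y s = ∞ := by
  set φ : (Σ i, T i) → Y := fun p => ⟨p.2, (hT p.1 p.2.2).1⟩
  have hφ : Function.Injective φ := by
    rintro ⟨i, x, hx⟩ ⟨j, y, hy⟩ h
    obtain rfl : x = y := congrArg (fun z : Y => (z : X)) h
    obtain rfl := hdisj i j x hx hy
    rfl
  refine top_le_iff.1 (le_trans ?_ (ENNReal.tsum_comp_le_tsum_of_injective hφ _))
  rw [ENNReal.tsum_sigma', ← ENNReal.tsum_const_eq_top_of_ne_zero (α := ℕ)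
    (ENNReal.ofReal_pos.2 ha).ne']
  refine ENNReal.tsum_le_tsum fun i => ?_
  calc ENNReal.ofReal a ≤ ENNReal.ofReal ((T i).ncard * Real.exp (-s * ρ i)) := by
        refine ENNReal.ofReal_le_ofReal ?_
        refine le_trans (le_of_eq ?_) (mul_le_mul_of_nonneg_right (hcard i) (Real.exp_pos _).le)
        rw [mul_assoc, ← Real.exp_add]
        simp
    _ = ∑' _ : T i, ENNReal.ofReal (Real.exp (-s * ρ i)) := by
        rw [ENNReal.tsum_set_const, ENNReal.ofReal_mul (by positivity), ← (hfin i).cast_ncard_eq]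
        simp
    _ ≤ _ := by
        refine ENNReal.tsum_le_tsum fun x => ENNReal.ofReal_le_ofReal (Real.exp_le_exp.2 ?_)
        have h1 : dist (x : X) o ≤ ρ i := (hT i x.2).2
        simp only [φ]
        nlinarith

end GrowthRate

/-! ### Growth of conjugates and injectivity on words -/

section Conjugates

variable {G : Type*} [Group G] {X : Type*} [MetricSpace X] [MulAction G X]
  [IsIsometricSMul G X] {o : X}

omit [IsIsometricSMul G X] in
theorem growthRate_le_of_subset_image (hG : IsMetricallyProper G o) {δ C : ℝ} (hC0 : 0 < C)
    (hC : ∀ r : ℝ, ({g : G | len o g ≤ r}.ncard : ℝ) ≤ C * Real.exp (δ * r)) {Y : Set X}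
    (f : G → X) {t B : ℝ}
    (hY : ∀ r, Y ∩ Metric.closedBall o r ⊆ f '' {g : G | len o g ≤ t * r + B}) :
    growthRate o Y ≤ (δ * t : ℝ) := by
  refine growthRate_le (C := C * Real.exp (δ * B)) (by positivity)
    (fun r => ((hG.finite_len_le _).image f).subset (hY r)) fun r => ?_
  have h1 := (Set.ncard_le_ncard (hY r) ((hG.finite_len_le _).image f)).trans
    (Set.ncard_image_le (hG.finite_len_le _))
  have h2 : ((Y ∩ Metric.closedBall o r).ncard : ℝ) ≤ {g : G | len o g ≤ t * r + B}.ncard := by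
    exact_mod_cast h1
  refine h2.trans ((hC _).trans (le_of_eq ?_))
  rw [mul_assoc, ← Real.exp_add]
  congr 2
  ring

omit [IsIsometricSMul G X] in
theorem growthRate_orbitSet_univ (hG : IsMetricallyProper G o) {δ Δ a C : ℝ} (ha : 0 < a)
    (hC0 : 0 < C)
    (hlow : ∀ r : ℝ, 0 ≤ r → a * Real.exp (δ * r) ≤ (orbitSet o (lenShell G o r Δ)).ncard)
    (hC : ∀ r : ℝ, ({g : G | len o g ≤ r}.ncard : ℝ) ≤ C * Real.exp (δ * r)) :
    growthRate o (orbitSet o (Set.univ : Set G)) = δ := by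
  refine le_antisymm ?_ ?_
  · have h := growthRate_le_of_subset_image hG hC0 hC (Y := orbitSet o (Set.univ : Set G))
      (fun g => g • o) (t := 1) (B := 0) (by
        rintro r x ⟨⟨g, -, rfl⟩, hx⟩
        refine ⟨g, ?_, rfl⟩
        rw [Metric.mem_closedBall, dist_comm] at hx
        change len o g ≤ _
        simpa using hx)
    rwa [mul_one] at h
  · refine le_growthRate (a := a * Real.exp (-(δ * Δ))) (by positivity)
      (ρ := fun i : ℕ => (i : ℝ) + Δ)
      (Filter.tendsto_atTop_add_const_right _ _ tendsto_natCast_atTop_atTop)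
      (fun i => orbitSet o (lenShell G o i Δ)) ?_ fun i => ?_
    · rintro i x ⟨g, hg, rfl⟩
      refine ⟨⟨g, trivial, rfl⟩, ?_⟩
      rw [Metric.mem_closedBall, dist_comm]
      exact hg.2.le
    · refine le_trans (le_of_eq ?_) (hlow i (by positivity))
      rw [mul_assoc, ← Real.exp_add]
      congr 2
      ring

variable {c : G} {k : ℝ}

theorem len_conj_le (g h : G) : len o (h * g * h⁻¹) ≤ 2 * len o h + len o g := by
  have h1 := len_mul_le o (h * g) h⁻¹
  have h2 := len_mul_le o h g
  rw [len_inv] at h1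
  linarith

theorem IsGood.le_len_conj (hne : ∀ x, (closestPoints (axis o c) x).Nonempty)
    (hk : HasDetourConstant (axis o c) k) (hk0 : 0 ≤ k) {h : G} (hh : IsGood o c k h)
    {n : ℤ} (hn : 100 * k < len o (c ^ n)) :
    2 * len o h - 17 * k ≤ len o (h * c ^ n * h⁻¹) := by
  have h1 := hh.detour hne hk hk0 hn (v := h⁻¹) (hh.inv.1.mono (by linarith))
  rw [len_inv] at h1
  linarith [dist_nonneg (x := o) (y := c ^ n • o)]

theorem IsGood.le_len_conj_mul (hne : ∀ x, (closestPoints (axis o c) x).Nonempty)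
    (hk : HasDetourConstant (axis o c) k) (hk0 : 0 ≤ k) {h : G} (hh : IsGood o c k h)
    {n : ℤ} (hn : 100 * k < len o (c ^ n)) (m : ℤ) :
    2 * len o h - 17 * k - len o (c ^ m) ≤ len o (h * c ^ n * h⁻¹ * c ^ m) := by
  have h1 := hh.le_len_conj hne hk hk0 hn
  have h2 := len_mul_le o (h * c ^ n * h⁻¹ * c ^ m) (c ^ m)⁻¹
  rw [mul_inv_cancel_right, len_inv] at h2
  linarith

/-- In a set of good elements whose words can be told apart, products of conjugates of `c ^ n`
separated by `c ^ m` can be told apart. -/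
theorem injOn_treeMap_conj (hne : ∀ x, (closestPoints (axis o c) x).Nonempty)
    (hk : HasDetourConstant (axis o c) k) (hk0 : 0 ≤ k) {n m : ℤ}
    (hn : 100 * k < len o (c ^ n)) (hm : 100 * k < len o (c ^ m)) {U : Set G}
    (hU : ∀ h ∈ U, IsGood o c k h ∧ 100 * k < len o h)
    (hcore : ∀ h ∈ U, ∀ h' ∈ U, ∀ v v' : G, ProjNear o c (7 * k) 1 (v • o) o →
      ProjNear o c (7 * k) 1 (v' • o) o →
      (h * c ^ n * h⁻¹ * c ^ m * v) • o = (h' * c ^ n * h'⁻¹ * c ^ m * v') • o → h = h') :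
    Set.InjOn (treeMap o (c ^ m)) (treesWorth ((fun h => h * c ^ n * h⁻¹) '' U)) := by
  have hnear_inv : ∀ h ∈ U, ∀ v : G, ProjNear o c (7 * k) 1 (v • o) o →
      ProjNear o c (7 * k) 1 ((h⁻¹ * c ^ m * v) • o) o := fun h hh v hv =>
    (hU h hh).1.inv.projNear_mul_zpow_mul hne hk hk0 (by rw [len_inv]; exact (hU h hh).2) hm hv
  have hassoc : ∀ h v : G, h * c ^ n * h⁻¹ * c ^ m * v = h * c ^ n * (h⁻¹ * c ^ m * v) := by
    intro h v
    group
  have hnear : ∀ l : List G, (∀ g ∈ l, g ∈ (fun h => h * c ^ n * h⁻¹) '' U) →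
      ProjNear o c (7 * k) 1 ((l.map fun g => g * c ^ m).prod • o) o := by
    intro l
    induction l with
    | nil => exact fun _ => by simpa using projNear_one (c := c) (o := o) (by linarith)
    | cons g l ih =>
      intro hl
      obtain ⟨h, hh, rfl⟩ := hl g (by simp)
      rw [List.map_cons, List.prod_cons, hassoc]
      exact (hU h hh).1.projNear_mul_zpow_mul hne hk hk0 (hU h hh).2 hn
        (hnear_inv h hh _ (ih fun g hg => hl g (by simp [hg])))
  -- A nonempty word moves `o`, which rules out that one word is a proper prefix of another with the
  -- same endpoint.
  have hnil : ∀ (g : G) (l : List G), (∀ x ∈ g :: l, x ∈ (fun h => h * c ^ n * h⁻¹) '' U) →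
      ((g :: l).map fun g => g * c ^ m).prod • o ≠ o := by
    intro g l hl heq
    obtain ⟨h, hh, rfl⟩ := hl g (by simp)
    rw [List.map_cons, List.prod_cons, hassoc] at heq
    have h1 := (hU h hh).1.detour hne hk hk0 hn
      (hnear_inv h hh _ (hnear l fun g hg => hl g (by simp [hg])))
    have h2 : len o (h * c ^ n * (h⁻¹ * c ^ m * (l.map fun g => g * c ^ m).prod)) = 0 := by
      rw [len, heq, dist_self]
    have h3 := (hU h hh).2
    have h4 : 0 ≤ len o (h⁻¹ * c ^ m * (l.map fun g => g * c ^ m).prod) := dist_nonneg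
    linarith
  have hinj : ∀ l l' : List G, (∀ g ∈ l, g ∈ (fun h => h * c ^ n * h⁻¹) '' U) →
      (∀ g ∈ l', g ∈ (fun h => h * c ^ n * h⁻¹) '' U) →
      (l.map fun g => g * c ^ m).prod • o = (l'.map fun g => g * c ^ m).prod • o → l = l' := by
    intro l
    induction l with
    | nil =>
      intro l' _ hl' heq
      cases l' with
      | nil => rfl
      | cons g' l' => exact absurd heq.symm (by simpa using hnil g' l' hl')
    | cons g l ih =>
      intro l' hl hl' heq
      cases l' with
      | nil => exact absurd heq (by simpa using hnil g l hl)
      | cons g' l' =>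
        obtain ⟨h, hh, rfl⟩ := hl g (by simp)
        obtain ⟨h', hh', rfl⟩ := hl' g' (by simp)
        have hl1 : ∀ g ∈ l, g ∈ (fun h => h * c ^ n * h⁻¹) '' U := fun g hg => hl g (by simp [hg])
        have hl1' : ∀ g ∈ l', g ∈ (fun h => h * c ^ n * h⁻¹) '' U :=
          fun g hg => hl' g (by simp [hg])
        rw [List.map_cons, List.prod_cons, List.map_cons, List.prod_cons] at heq
        obtain rfl := hcore h hh h' hh' _ _ (hnear l hl1) (hnear l' hl1') heq
        simp only [mul_smul, smul_left_cancel_iff] at heq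
        rw [ih l' hl1 hl1' heq]
  exact fun l hl l' hl' heq => hinj l l' (fun g hg => (hl.2 g hg).1) (fun g hg => (hl'.2 g hg).1) heq

end Conjugates

end Cogrowth

/-! ### Assembly of the proposition -/

theorem proposition3p1 {G : Type*} [Group G] {X : Type*} [MetricSpace X]
    [MulAction G X] [IsIsometricSMul G X] (o : X)
    (hgeod : Cogrowth.IsGeodesicSpace X)
    (hproper : Cogrowth.IsMetricallyProper G o)
    (hgrowth : Cogrowth.HasPurelyExponentialGrowth o
      (Cogrowth.orbitSet o (Set.univ : Set G)))
    (c : G) (hc : Cogrowth.IsStronglyContractingElement o c) :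
    ∃ p : ℕ, 1 ≤ p ∧ ∃ G₄ : Set G, G₄ ⊆ conjugatesOf (c ^ p) ∧
      Cogrowth.IsDivergent o (Cogrowth.orbitSet o G₄) ∧
      Cogrowth.growthRate o (Cogrowth.orbitSet o G₄) =
        Cogrowth.growthRate o (Cogrowth.orbitSet o (Set.univ : Set G)) / 2 ∧
      Set.InjOn (Cogrowth.treeMap o ((c ^ p) ^ 2)) (Cogrowth.treesWorth G₄) := by
  open Cogrowth in
  have hne := closestPoints_axis_nonempty hproper c
  obtain ⟨K, hK0, hK⟩ :=
    IsStronglyContractingSet.exists_detourConstant hgeod (Y := axis o c) hc.2 hne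
  obtain ⟨δ, hδ, Δ, hΔ, a, ha, C, hC0, hlow, hC⟩ := exists_growth_bounds hproper hgrowth
  have hlow' : ∀ r : ℝ, 0 ≤ r → a * Real.exp (δ * r) ≤ (lenShell G o r Δ).ncard := fun r hr => by
    refine (hlow r hr).trans ?_
    exact_mod_cast Set.ncard_image_le (hproper.finite_lenShell r Δ)
  obtain ⟨k, hKk, hgood⟩ := exists_isGood_growth hgeod hproper hc.1 hK0 hK hδ ha hC0 hlow' hC
  have hk0 : 0 ≤ k := hK0.trans hKk
  have hk : HasDetourConstant (axis o c) k := fun x y q r hq hr =>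
    (hK x y q r hq hr).imp (fun h => h.trans hKk) fun h => h.trans (by linarith)
  obtain ⟨M, hM⟩ := hproper.exists_natAbs_le hc.1 (100 * k)
  -- With `p = M + 1`, both `n = p` and `m = 2 * p` exceed `M`, so `c ^ n` and `c ^ m` move `o` by
  -- more than `100 * k`.
  obtain ⟨n, hn_def⟩ : ∃ n : ℤ, n = (M + 1 : ℕ) := ⟨_, rfl⟩
  obtain ⟨m, hm_def⟩ : ∃ m : ℤ, m = ((M + 1) * 2 : ℕ) := ⟨_, rfl⟩
  have hn : 100 * k < len o (c ^ n) := by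
    by_contra! h
    have := hM n h
    omega
  have hm : 100 * k < len o (c ^ m) := by
    by_contra! h
    have := hM m h
    omega
  set B : ℝ := len o (c ^ n) + len o (c ^ m) + 2 * Δ + 200 * k + 1 with hB
  have hn0 : 0 ≤ len o (c ^ n) := dist_nonneg
  have hm0 : 0 ≤ len o (c ^ m) := dist_nonneg
  -- The values of `κ` and `D` are the error terms of `IsGood.dist_le_of_eq_of_lt` and
  -- `IsGood.dist_le_of_eq`, so that the selection contradicts the former and turns closeness in the
  -- latter into equality.
  obtain ⟨S, r, a', ha', hri, hrB, hrr, hSsub, hScard, hSsep, hSfar⟩ :=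
    exists_sparse_family hproper hδ (half_pos ha) hC0 hC (P := IsGood o c k) hgood
      (fun h => h * c ^ n * h⁻¹ * c ^ m) (B := B) (κ := 35 * k) (D := Δ + 23 * k) (by positivity)
      (fun h hh _ => by
        have := hh.le_len_conj_mul hne hk hk0 hn m
        linarith)
  set f : G → G := fun h => h * c ^ n * h⁻¹ with hf
  have hSgood : ∀ i, ∀ h ∈ S i, IsGood o c k h := fun i h hh => (hSsub i hh).2
  have hSlow : ∀ i, ∀ h ∈ S i, r i ≤ len o h := fun i h hh => (hSsub i hh).1.1
  have hSup : ∀ i, ∀ h ∈ S i, len o h < r i + Δ := fun i h hh => (hSsub i hh).1.2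
  have hSlen : ∀ i, ∀ h ∈ S i, 100 * k < len o h := fun i h hh => by
    linarith [hSlow i h hh, hrB i]
  have hsame : ∀ i, ∀ h ∈ S i, ∀ h' ∈ S i, ∀ v v' : G, ProjNear o c (7 * k) 1 (v • o) o →
      ProjNear o c (7 * k) 1 (v' • o) o →
      (h * c ^ n * v) • o = (h' * c ^ n * v') • o → h = h' := by
    intro i h hh h' hh' v v' hv hv' heq
    refine hSsep i h hh h' hh' ((hSgood i h hh).dist_le_of_eq hne hk hk0 (hSgood i h' hh') hn
      hv hv' hΔ.le ?_ heq)
    rw [abs_le]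
    constructor <;> linarith [hSlow i h hh, hSup i h hh, hSlow i h' hh', hSup i h' hh']
  have hnear : ∀ i, ∀ h ∈ S i, ∀ v : G, ProjNear o c (7 * k) 1 (v • o) o →
      ProjNear o c (7 * k) 1 ((h⁻¹ * c ^ m * v) • o) o := fun i h hh v hv =>
    (hSgood i h hh).inv.projNear_mul_zpow_mul hne hk hk0
      (by rw [len_inv]; exact hSlen i h hh) hm hv
  have hassoc : ∀ h v : G, h * c ^ n * h⁻¹ * c ^ m * v = h * c ^ n * (h⁻¹ * c ^ m * v) := by
    intro h v
    group
  have hdiff : ∀ i j, i < j → ∀ h ∈ S i, ∀ h' ∈ S j, ∀ v v' : G,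
      ProjNear o c (7 * k) 1 (v • o) o → ProjNear o c (7 * k) 1 (v' • o) o →
      (h * c ^ n * h⁻¹ * c ^ m * v) • o ≠ (h' * c ^ n * h'⁻¹ * c ^ m * v') • o := by
    intro i j hij h hh h' hh' v v' hv hv' heq
    rw [hassoc h'] at heq
    have h1 := (hSgood i h hh).dist_le_of_eq_of_lt hne hk hk0 (hSgood j h' hh') (hSlen i h hh)
      hn hm hv (hnear j h' hh' v' hv') (by
        have h2 := len_mul_le o (h * c ^ n * h⁻¹) (c ^ m)
        have h3 := len_conj_le (o := o) (c ^ n) h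
        linarith [hSup i h hh, hSlow j h' hh', hrr i j hij]) heq
    exact absurd h1 (not_le.2 (hSfar i j hij h hh h' hh'))
  -- Conjugates from different levels differ in length, which makes the sets `T i` below disjoint.
  have hlen_lt : ∀ i j, i < j → ∀ h ∈ S i, ∀ h' ∈ S j, len o (f h) < len o (f h') := by
    intro i j hij h hh h' hh'
    have h1 := (hSgood j h' hh').le_len_conj hne hk hk0 hn
    have h2 := len_conj_le (o := o) (c ^ n) h
    simp only [hf]
    linarith [hSup i h hh, hSlow j h' hh', hrr i j hij, hrB j]
  have hfinj : ∀ i j, ∀ h ∈ S i, ∀ h' ∈ S j, f h • o = f h' • o → i = j ∧ h = h' := by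
    intro i j h hh h' hh' heq
    have hlen : len o (f h) = len o (f h') := by rw [len, len, heq]
    rcases lt_trichotomy i j with hij | rfl | hij
    · exact absurd hlen (hlen_lt i j hij h hh h' hh').ne
    · exact ⟨rfl, hsame i h hh h' hh' h⁻¹ h'⁻¹ ((hSgood i h hh).inv.1.mono (by linarith))
        ((hSgood i h' hh').inv.1.mono (by linarith)) heq⟩
    · exact absurd hlen (hlen_lt j i hij h' hh' h hh).ne'
  set U : Set G := ⋃ i, S i with hU
  have hSU : ∀ i, S i ⊆ U := fun i => Set.subset_iUnion S i
  have hinj : Set.InjOn (treeMap o (c ^ m)) (treesWorth (f '' U)) := by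
    refine injOn_treeMap_conj hne hk hk0 hn hm (fun h hh => ?_) ?_
    · obtain ⟨i, hi⟩ := Set.mem_iUnion.1 hh
      exact ⟨hSgood i h hi, hSlen i h hi⟩
    · intro h hh h' hh' v v' hv hv' heq
      obtain ⟨i, hi⟩ := Set.mem_iUnion.1 hh
      obtain ⟨j, hj⟩ := Set.mem_iUnion.1 hh'
      rcases lt_trichotomy i j with hij | rfl | hij
      · exact absurd heq (hdiff i j hij h hi h' hj v v' hv hv')
      · rw [hassoc, hassoc] at heq
        exact hsame i h hi h' hj _ _ (hnear i h hi v hv) (hnear i h' hj v' hv') heq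
      · exact absurd heq.symm (hdiff j i hij h' hj h hi v' v hv' hv)
  have hSfin : ∀ i, (S i).Finite := fun i =>
    (hproper.finite_lenShell (r i) Δ).subset fun h hh => (hSsub i hh).1
  set ρ : ℕ → ℝ := fun i => 2 * r i + (2 * Δ + len o (c ^ n)) with hρ_def
  set T : ℕ → Set X := fun i => (fun h => f h • o) '' S i with hT_def
  have hρ : Filter.Tendsto ρ Filter.atTop Filter.atTop :=
    Filter.tendsto_atTop_add_const_right _ _
      ((Filter.tendsto_atTop_mono hri tendsto_natCast_atTop_atTop).const_mul_atTop two_pos)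
  have hT : ∀ i, T i ⊆ orbitSet o (f '' U) ∩ Metric.closedBall o (ρ i) := by
    rintro i x ⟨h, hh, rfl⟩
    refine ⟨⟨f h, ⟨h, hSU i hh, rfl⟩, rfl⟩, ?_⟩
    rw [Metric.mem_closedBall, dist_comm]
    have h1 : len o (f h) ≤ 2 * len o h + len o (c ^ n) := len_conj_le (o := o) (c ^ n) h
    have h2 := hSup i h hh
    change len o (f h) ≤ 2 * r i + (2 * Δ + len o (c ^ n))
    linarith
  set a'' : ℝ := a' * Real.exp (-(δ / 2 * (2 * Δ + len o (c ^ n)))) with ha''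
  have hTcard : ∀ i, a'' * Real.exp (δ / 2 * ρ i) ≤ (T i).ncard := by
    intro i
    have h1 : (T i).ncard = (S i).ncard := Set.InjOn.ncard_image
      fun h hh h' hh' heq => (hfinj i i h hh h' hh' heq).2
    rw [h1]
    refine le_trans (le_of_eq ?_) (hScard i)
    rw [ha'', mul_assoc, ← Real.exp_add]
    congr 2
    simp only [hρ_def]
    ring
  have hrate : growthRate o (orbitSet o (f '' U)) = ((δ / 2 : ℝ) : EReal) := by
    refine le_antisymm ?_ (le_growthRate (by positivity) hρ T hT hTcard)
    -- A conjugate of length at most `s` comes from an `h` of length at most `s / 2 + 17 / 2 * k`,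
    -- by `IsGood.le_len_conj`.
    have h1 := growthRate_le_of_subset_image hproper hC0 hC (Y := orbitSet o (f '' U))
      (fun h => f h • o) (t := 1 / 2) (B := 17 / 2 * k) (by
        rintro s x ⟨⟨_, ⟨h, hh, rfl⟩, rfl⟩, hx⟩
        refine ⟨h, ?_, rfl⟩
        obtain ⟨i, hi⟩ := Set.mem_iUnion.1 hh
        rw [Metric.mem_closedBall, dist_comm] at hx
        have h2 := (hSgood i h hi).le_len_conj hne hk hk0 hn
        change len o (f h) ≤ s at hx
        change len o h ≤ _
        simp only [hf] at hx
        linarith)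
    rwa [mul_one_div] at h1
  have hTdisj : ∀ i j x, x ∈ T i → x ∈ T j → i = j := by
    rintro i j x ⟨h, hh, rfl⟩ ⟨h', hh', heq⟩
    exact (hfinj i j h hh h' hh' heq.symm).1
  refine ⟨M + 1, by omega, f '' U, ?_, ⟨δ / 2, hrate, poincareSeries_eq_top (by positivity)
    (by positivity) T hT hTdisj (fun i => (hSfin i).image _) hTcard⟩, ?_, ?_⟩
  · rintro _ ⟨h, -, rfl⟩
    refine isConj_iff.2 ⟨h, ?_⟩
    simp only [hf, hn_def, zpow_natCast]
  · rw [hrate, growthRate_orbitSet_univ hproper ha hC0 hlow hC, EReal.coe_div]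
    rfl
  · rwa [hm_def, zpow_natCast, pow_mul] at hinj
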